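/- Let $m\ge 1$ be an integer, let $\zeta$ be the Riemann zeta function and let $$A=\lim_{n\to\infty}\frac{1^1 2^2\cdots n^n}{n^{n^2/2+n/2+1/12}\,e^{-n^2/4}}$$ be the Glaisher–Kinkelin constant. Define the sequences $(a_n)$, $(b_n)$, $(c_n)$ as the coefficients of the formal power series $$\sum_{n\ge0}a_nq^n=\prod_{k=1}^{\infty}\left(\frac{1+q^k}{1-q^k}\right)^{mk},\qquad \sum_{n\ge0}b_nq^n=\prod_{k=1}^{\infty}\frac1{(1-q^k)^{mk}},\qquad \sum_{n\ge0}c_nq^n=\prod_{k=1}^{\infty}(1+q^k)^{mk}.$$ Then, as $n\to\infty$, $$a_n\sim\frac{(7m\zeta(3))^{\frac16+\frac m{36}}\exp\left(\frac m{12}+\frac{3(7m\zeta(3))^{1/3}n^{2/3}}{2^{4/3}}\right)}{A^m\,2^{\frac23+\frac m9}\,\sqrt3\,\pi^{1/2}\,n^{\frac23+\frac m{36}}},$$ $$b_n\sim\frac{(m\zeta(3))^{\frac m{36}+\frac16}\exp\left(\frac m{12}+\frac{3(m\zeta(3))^{1/3}n^{2/3}}{2^{2/3}}\right)}{A^m\,2^{\frac13-\frac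 m{36}}\,3^{1/2}\,\pi^{1/2}\,n^{\frac m{36}+\frac23}},$$ $$c_n\sim\frac{(m\zeta(3))^{1/6}\exp\left(\frac{3^{4/3}(m\zeta(3))^{1/3}n^{2/3}}{2^{4/3}}\right)}{2^{\frac m{12}+\frac23}\,3^{1/3}\,\sqrt\pi\,n^{2/3}}.$$ -/

import Mathlib

open Filter Topology Asymptotics
open scoped PowerSeries.WithPiTopology

/-! ### The generating functions

Formal power series over `ℝ`, with the topology of coefficientwise convergence.  The infinite
products over the integers `k ≥ 1` are indexed by `k + 1` with `k : ℕ`. -/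

/-- The formal power series `∏_{k ≥ 1} 1 / (1 - q^k)^(m k)`. -/
noncomputable def genMinus (m : ℕ) : PowerSeries ℝ :=
  ∏' k : ℕ, ((1 - PowerSeries.X ^ (k + 1))⁻¹) ^ (m * (k + 1))

/-- The formal power series `∏_{k ≥ 1} (1 + q^k)^(m k)`. -/
noncomputable def genPlus (m : ℕ) : PowerSeries ℝ :=
  ∏' k : ℕ, (1 + PowerSeries.X ^ (k + 1)) ^ (m * (k + 1))

/-- The formal power series `∏_{k ≥ 1} ((1 + q^k) / (1 - q^k))^(m k)`. -/
noncomputable def genRatio (m : ℕ) : PowerSeries ℝ :=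
  ∏' k : ℕ, ((1 + PowerSeries.X ^ (k + 1)) * (1 - PowerSeries.X ^ (k + 1))⁻¹) ^ (m * (k + 1))

/-! The three infinite products converge. -/

theorem multipliable_of_X_pow_dvd (f : ℕ → PowerSeries ℝ)
    (h : ∀ k, PowerSeries.X ^ (k + 1) ∣ f k - 1) : Multipliable f := by
  have hf : f = fun k => 1 + (f k - 1) := by
    funext k
    ring
  rw [hf]
  apply PowerSeries.WithPiTopology.multipliable_one_add_of_tendsto_order_atTop_nhds_top
  refine ENat.tendsto_nhds_top_iff_natCast_lt.mpr fun n => eventually_atTop.mpr ⟨n, fun k hk => ?_⟩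
  have h1 : ((k + 1 : ℕ) : ℕ∞) ≤ (f k - 1).order := by
    refine PowerSeries.nat_le_order _ _ fun i hi => ?_
    exact PowerSeries.X_pow_dvd_iff.mp (h k) i hi
  refine lt_of_lt_of_le ?_ h1
  exact_mod_cast Nat.lt_succ_of_le hk

theorem X_pow_dvd_pow_sub_one (n j : ℕ) (g : PowerSeries ℝ) (h : PowerSeries.X ^ n ∣ g - 1) :
    PowerSeries.X ^ n ∣ g ^ j - 1 := by
  have h2 := sub_dvd_pow_sub_pow g 1 j
  rw [one_pow] at h2
  exact h.trans h2

theorem one_sub_X_pow_mul_inv (k : ℕ) :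
    (1 - PowerSeries.X ^ (k + 1) : PowerSeries ℝ) * (1 - PowerSeries.X ^ (k + 1))⁻¹ = 1 :=
  PowerSeries.mul_inv_cancel _ (by simp)

theorem multipliable_genMinus (m : ℕ) : Multipliable fun k : ℕ =>
    ((1 - PowerSeries.X ^ (k + 1) : PowerSeries ℝ)⁻¹) ^ (m * (k + 1)) := by
  refine multipliable_of_X_pow_dvd _ fun k => X_pow_dvd_pow_sub_one _ _ _ ?_
  exact ⟨(1 - PowerSeries.X ^ (k + 1))⁻¹, by linear_combination one_sub_X_pow_mul_inv k⟩

theorem multipliable_genPlus (m : ℕ) : Multipliable fun k : ℕ =>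
    (1 + PowerSeries.X ^ (k + 1) : PowerSeries ℝ) ^ (m * (k + 1)) := by
  refine multipliable_of_X_pow_dvd _ fun k => X_pow_dvd_pow_sub_one _ _ _ ?_
  exact ⟨1, by ring⟩

theorem multipliable_genRatio (m : ℕ) : Multipliable fun k : ℕ =>
    ((1 + PowerSeries.X ^ (k + 1) : PowerSeries ℝ) * (1 - PowerSeries.X ^ (k + 1))⁻¹)
      ^ (m * (k + 1)) := by
  refine multipliable_of_X_pow_dvd _ fun k => X_pow_dvd_pow_sub_one _ _ _ ?_
  exact ⟨2 * (1 - PowerSeries.X ^ (k + 1))⁻¹, by linear_combination one_sub_X_pow_mul_inv k⟩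

/-! ### The Glaisher–Kinkelin constant -/

/-- The sequence `(1^1 2^2 ⋯ n^n) / (n^(n²/2 + n/2 + 1/12) e^(-n²/4))`. -/
noncomputable def glaisherSeq (n : ℕ) : ℝ :=
  (∏ k ∈ Finset.Icc 1 n, (k : ℝ) ^ k) /
    ((n : ℝ) ^ ((n : ℝ) ^ 2 / 2 + (n : ℝ) / 2 + 1 / 12) * Real.exp (-(n : ℝ) ^ 2 / 4))

/-- The Glaisher–Kinkelin constant `A = 1.28242712…`, the limit of
`(1^1 2^2 ⋯ n^n) / (n^(n²/2 + n/2 + 1/12) e^(-n²/4))` as `n → ∞`. -/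
noncomputable def glaisherKinkelin : ℝ := limUnder atTop glaisherSeq

/-! The limit exists and is positive. -/

theorem glaisherSeq_pos {n : ℕ} (hn : 0 < n) : 0 < glaisherSeq n := by
  have hn' : (0 : ℝ) < n := by exact_mod_cast hn
  refine div_pos (Finset.prod_pos fun k hk => ?_) (by positivity)
  have : 0 < k := (Finset.mem_Icc.mp hk).1
  positivity

theorem log_glaisherSeq_succ_sub (n : ℕ) (hn : 0 < n) :
    Real.log (glaisherSeq (n + 1)) - Real.log (glaisherSeq n) =
      ((n + 1 : ℝ) ^ 2 / 2 - (n + 1 : ℝ) / 2 + 1 / 12) * Real.log (1 - 1 / (n + 1 : ℝ))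
        + (n + 1 : ℝ) / 2 - 1 / 4 := by
  have key : ∀ j : ℕ, 0 < j → Real.log (glaisherSeq j) =
      Real.log (∏ k ∈ Finset.Icc 1 j, (k : ℝ) ^ k)
        - (((j : ℝ) ^ 2 / 2 + (j : ℝ) / 2 + 1 / 12) * Real.log j - (j : ℝ) ^ 2 / 4) := by
    intro j hj
    have hj' : (0 : ℝ) < j := by exact_mod_cast hj
    have hp : 0 < ∏ k ∈ Finset.Icc 1 j, (k : ℝ) ^ k := Finset.prod_pos fun k hk => by
      have : 0 < k := (Finset.mem_Icc.mp hk).1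
      positivity
    rw [glaisherSeq, Real.log_div hp.ne' (by positivity),
      Real.log_mul (by positivity) (Real.exp_pos _).ne', Real.log_rpow hj', Real.log_exp]
    ring
  have hn' : (0 : ℝ) < n := by exact_mod_cast hn
  have hp : 0 < ∏ k ∈ Finset.Icc 1 n, (k : ℝ) ^ k := Finset.prod_pos fun k hk => by
    have : 0 < k := (Finset.mem_Icc.mp hk).1
    positivity
  have hl : Real.log (1 - 1 / (n + 1 : ℝ)) = Real.log n - Real.log (n + 1) := by
    rw [← Real.log_div hn'.ne' (by positivity)]
    congr 1
    field_simp
    ring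
  rw [key _ hn, key _ n.succ_pos, Finset.prod_Icc_succ_top (by omega), hl,
    Real.log_mul hp.ne' (by positivity), Real.log_pow]
  push_cast
  ring

theorem abs_log_glaisherSeq_succ_sub_le (n : ℕ) (hn : 0 < n) :
    |Real.log (glaisherSeq (n + 1)) - Real.log (glaisherSeq n)| ≤ 3 / (n + 1 : ℝ) ^ 2 := by
  rw [log_glaisherSeq_succ_sub n hn]
  have hn' : (1 : ℝ) ≤ n := by exact_mod_cast hn
  set N : ℝ := (n : ℝ) + 1 with hN
  obtain ⟨x, hx⟩ : ∃ x : ℝ, x = 1 / N := ⟨_, rfl⟩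
  have hx0 : 0 < x := by rw [hx]; positivity
  have hx2 : x ≤ 1 / 2 := by
    rw [hx]
    exact one_div_le_one_div_of_le (by norm_num) (by linarith)
  have hNx : N = 1 / x := by rw [hx, one_div_one_div]
  rw [hNx, one_div_one_div]
  have hlog := Real.abs_log_sub_add_sum_range_le (x := x) (by rw [abs_of_pos hx0]; linarith) 3
  simp only [Finset.sum_range_succ, Finset.sum_range_zero, abs_of_pos hx0] at hlog
  norm_num at hlog
  set L := Real.log (1 - x)
  obtain ⟨e, he⟩ : ∃ e : ℝ, e = x + x ^ 2 / 2 + x ^ 3 / 3 + L := ⟨_, rfl⟩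
  have hL : L = e - x - x ^ 2 / 2 - x ^ 3 / 3 := by linarith
  rw [← he] at hlog
  have he2 : |e| ≤ 2 * x ^ 4 := by
    refine hlog.trans ?_
    rw [div_le_iff₀ (by linarith)]
    nlinarith [pow_pos hx0 4]
  have hP : ((1 / x) ^ 2 / 2 - 1 / x / 2 + 1 / 12) * L + 1 / x / 2 - 1 / 4 =
      ((1 / x) ^ 2 / 2 - 1 / x / 2 + 1 / 12) * e + (x ^ 2 / 8 - x ^ 3 / 36) := by
    rw [hL]
    field_simp
    ring
  rw [hP]
  have h1 : |(1 / x) ^ 2 / 2 - 1 / x / 2 + 1 / 12| ≤ (1 / x) ^ 2 := by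
    have : 2 ≤ 1 / x := by
      rw [le_div_iff₀ hx0]
      linarith
    rw [abs_le]
    constructor <;> nlinarith
  have h2 : |((1 / x) ^ 2 / 2 - 1 / x / 2 + 1 / 12) * e| ≤ 2 * x ^ 2 := by
    rw [abs_mul]
    calc _ ≤ (1 / x) ^ 2 * (2 * x ^ 4) := by gcongr
      _ = 2 * x ^ 2 := by field_simp
  have h3 : |x ^ 2 / 8 - x ^ 3 / 36| ≤ x ^ 2 := by
    have : x ^ 3 ≤ x ^ 2 := by nlinarith [sq_nonneg x]
    rw [abs_le]
    constructor <;> nlinarith [pow_pos hx0 3, pow_pos hx0 2]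
  have h4 : 3 / (1 / x) ^ 2 = 3 * x ^ 2 := by field_simp
  rw [h4]
  exact (abs_add_le _ _).trans (by linarith)

theorem exists_pos_tendsto_glaisherSeq :
    ∃ a : ℝ, 0 < a ∧ Tendsto glaisherSeq atTop (𝓝 a) := by
  set u : ℕ → ℝ := fun n => Real.log (glaisherSeq (n + 1)) with hu
  have hs : Summable fun n : ℕ => 3 / ((n : ℝ) + 1 + 1) ^ 2 := by
    have h := (summable_nat_add_iff (f := fun n : ℕ => 3 * (1 / (n : ℝ) ^ 2)) 2).mpr
      ((Real.summable_one_div_nat_pow.mpr (by norm_num)).mul_left 3)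
    refine h.congr fun n => ?_
    push_cast
    ring
  have hc : CauchySeq u := by
    refine cauchySeq_of_dist_le_of_summable _ (fun n => ?_) hs
    rw [dist_comm, Real.dist_eq]
    have := abs_log_glaisherSeq_succ_sub_le (n + 1) n.succ_pos
    push_cast at this
    exact this
  obtain ⟨l, hl⟩ := cauchySeq_tendsto_of_complete hc
  refine ⟨Real.exp l, Real.exp_pos l, ?_⟩
  rw [← tendsto_add_atTop_iff_nat 1]
  refine ((Real.continuous_exp.tendsto l).comp hl).congr fun n => ?_
  simp only [hu, Function.comp_apply]
  exact Real.exp_log (glaisherSeq_pos n.succ_pos)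

theorem tendsto_glaisherSeq : Tendsto glaisherSeq atTop (𝓝 glaisherKinkelin) := by
  obtain ⟨a, -, ha⟩ := exists_pos_tendsto_glaisherSeq
  exact tendsto_nhds_limUnder ⟨a, ha⟩

theorem glaisherKinkelin_pos : 0 < glaisherKinkelin := by
  obtain ⟨a, h0, ha⟩ := exists_pos_tendsto_glaisherSeq
  rwa [tendsto_nhds_unique tendsto_glaisherSeq ha]

/-! ### Apéry's constant -/

/-- The real number `ζ(3)`. -/
noncomputable def zetaThree : ℝ := (riemannZeta 3).re

/-!
The three generating functions are handled together, through the function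
`S(z) = ∑_{k ≥ 1} -k log (1 - e^(-kz))` (`logMacMahon`), `Re z > 0`. At `q = e^(-z)` the products
`genMinus`, `genPlus` and `genRatio` are `exp (m S(z))`, `exp (m (S(z) - S(2z)))` and
`exp (m (2 S(z) - S(2z)))`. That the formal products may be evaluated in this way
(`HasEval.tprod`) follows from the nonnegativity of the coefficients.

*The logarithm near `0`.* As `z → 0` in the sector `|z| ≤ 2 Re z`,
`S(z) = ζ(3) / z² + (log z) / 12 + 1 / 12 - log A + o(1)` (`tendsto_logMacMahon_sub`). This is the
Euler–Maclaurin formula with third-order remainder for the function `x ↦ -x log (1 - e^(-xz))`,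
summed over `[1, ∞)`. Its integral over `(0, ∞)` is `ζ(3) / z²`; the boundary terms at `1` and the
integral over `(0, 1)` account for `log z`. The third derivative is at most `44 / x²` in the sector
and tends to `1 / x²`, which is the opposite of the third derivative of `x log x`, so by dominated
convergence the remainder tends to the opposite of that of `x log x`. The latter is `log A - 1 / 4`
by the definition of the Glaisher–Kinkelin constant.

*The saddle point.* Suppose the generating function is `exp (M z)` with
`M z = c / z² + β log z + κ + o(1)`. Cauchy's formula on the circle `|q| = e^(-t)`, where
`t = (2c / n)^(1/3)` minimizes `c / t² + n t`, is written with the argument of `q` scaled by `t²`.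
The integrand, divided by its value on the real axis, tends to `exp (-3 c u²)`, and
`tendsto_coeff_div_saddle` follows by dominated convergence.

*Domination.* Each factor `p(w)` of the three products satisfies
`|p(w)| ≤ p(|w|) exp (-(|w| - Re w) / 4)`, so the generating function at `q`, relative to its value
at `|q|`, is at most `exp (-(1 / 4) ∑ k (|q|^k - Re q^k))`. The sum is evaluated by means of
`∑ k q^k = q / (1 - q)²`, and is at least a multiple of `|u| - 1` on the scale of the saddle point
(`norm_exp_le_of_tendsto_prod`).
-/

/-! ### Evaluation of formal infinite products -/

/-- The power series `f` converges absolutely at `q`, with sum `v`. -/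
def HasEval (f : PowerSeries ℝ) (q v : ℂ) : Prop :=
  Summable (fun n => ‖((PowerSeries.coeff n f : ℝ) : ℂ) * q ^ n‖) ∧
    ∑' n, ((PowerSeries.coeff n f : ℝ) : ℂ) * q ^ n = v

theorem HasEval.mul {f g : PowerSeries ℝ} {q v w : ℂ} (hf : HasEval f q v) (hg : HasEval g q w) :
    HasEval (f * g) q (v * w) := by
  have key : (fun n => ((PowerSeries.coeff n (f * g) : ℝ) : ℂ) * q ^ n) = fun n =>
      ∑ kl ∈ Finset.HasAntidiagonal.antidiagonal n,
        (((PowerSeries.coeff kl.1 f : ℝ) : ℂ) * q ^ kl.1) *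
        (((PowerSeries.coeff kl.2 g : ℝ) : ℂ) * q ^ kl.2) := by
    funext n
    rw [PowerSeries.coeff_mul, Complex.ofReal_sum, Finset.sum_mul]
    refine Finset.sum_congr rfl fun kl hkl => ?_
    rw [← Finset.HasAntidiagonal.mem_antidiagonal.mp hkl, pow_add]
    push_cast
    ring
  constructor
  · have := summable_norm_sum_mul_antidiagonal_of_summable_norm hf.1 hg.1
    simpa only [← key, funext_iff] using this.congr fun n => by rw [← congrFun key n]
  · rw [key, ← tsum_mul_tsum_eq_tsum_sum_antidiagonal_of_summable_norm hf.1 hg.1, hf.2, hg.2]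

theorem HasEval.one (q : ℂ) : HasEval 1 q 1 := by
  have h : ∀ n ≠ 0, ((PowerSeries.coeff n (1 : PowerSeries ℝ) : ℝ) : ℂ) * q ^ n = 0 :=
    fun n hn => by simp [PowerSeries.coeff_one, hn]
  refine ⟨summable_of_ne_finset_zero (s := {0}) fun n hn => ?_, ?_⟩
  · rw [h n (by simpa using hn), norm_zero]
  · rw [tsum_eq_single 0 h]
    simp

theorem HasEval.one_add_X_pow (q : ℂ) {k : ℕ} (hk : k ≠ 0) :
    HasEval (1 + PowerSeries.X ^ k) q (1 + q ^ k) := by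
  have h : ∀ n ∉ ({0, k} : Finset ℕ),
      ((PowerSeries.coeff n (1 + PowerSeries.X ^ k : PowerSeries ℝ) : ℝ) : ℂ) * q ^ n = 0 := by
    intro n hn
    simp only [Finset.mem_insert, Finset.mem_singleton, not_or] at hn
    simp [PowerSeries.coeff_one, PowerSeries.coeff_X_pow, hn.1, hn.2]
  refine ⟨summable_of_ne_finset_zero (s := {0, k}) fun n hn => ?_, ?_⟩
  · rw [h n hn, norm_zero]
  · rw [tsum_eq_sum h, Finset.sum_pair hk.symm]
    simp [PowerSeries.coeff_X_pow, PowerSeries.coeff_one, hk]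

theorem HasEval.pow {f : PowerSeries ℝ} {q v : ℂ} (hf : HasEval f q v) (j : ℕ) :
    HasEval (f ^ j) q (v ^ j) := by
  induction j with
  | zero => simpa using HasEval.one q
  | succ j ih => simpa only [pow_succ] using ih.mul hf

theorem HasEval.prod_range {f : ℕ → PowerSeries ℝ} {q : ℂ} {v : ℕ → ℂ}
    (hf : ∀ k, HasEval (f k) q (v k)) (K : ℕ) :
    HasEval (∏ k ∈ Finset.range K, f k) q (∏ k ∈ Finset.range K, v k) := by
  induction K with
  | zero => simpa using HasEval.one q
  | succ K ih => simpa only [Finset.prod_range_succ] using ih.mul (hf K)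

/-- The geometric series in `X ^ k`, by its coefficients. -/
theorem inv_one_sub_X_pow {k : ℕ} (hk : k ≠ 0) :
    (1 - PowerSeries.X ^ k : PowerSeries ℝ)⁻¹ = PowerSeries.mk fun n => if k ∣ n then 1 else 0 := by
  symm
  rw [PowerSeries.eq_inv_iff_mul_eq_one (by simp [hk])]
  ext n
  rw [mul_sub, mul_one, map_sub, PowerSeries.coeff_mul_X_pow', PowerSeries.coeff_one]
  simp only [PowerSeries.coeff_mk]
  rcases lt_or_ge n k with h | h
  · rcases Nat.eq_zero_or_pos n with rfl | hn
    · simp [hk]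
    · simp [h.not_ge, hn.ne', Nat.not_dvd_of_pos_of_lt hn h]
  · have hn : n ≠ 0 := by omega
    have hd : k ∣ n - k ↔ k ∣ n := Nat.dvd_sub_iff_left h dvd_rfl
    simp only [h, hn, hd, if_true, if_false, sub_self]

theorem HasEval.inv_one_sub_X_pow {q : ℂ} (hq : ‖q‖ < 1) {k : ℕ} (hk : k ≠ 0) :
    HasEval ((1 - PowerSeries.X ^ k)⁻¹) q (1 - q ^ k)⁻¹ := by
  set G : PowerSeries ℝ := (1 - PowerSeries.X ^ k)⁻¹ with hG
  have hs : Summable (fun n => ‖((PowerSeries.coeff n G : ℝ) : ℂ) * q ^ n‖) := by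
    refine Summable.of_nonneg_of_le (fun _ => norm_nonneg _) (fun n => ?_)
      (summable_geometric_of_lt_one (norm_nonneg q) hq)
    rw [hG, _root_.inv_one_sub_X_pow hk, PowerSeries.coeff_mk, norm_mul, norm_pow]
    split_ifs <;> simp
  have h1 : HasEval G q _ := ⟨hs, rfl⟩
  have h2 : HasEval (1 - PowerSeries.X ^ k) q (1 - q ^ k) := by
    have h : ∀ n ∉ ({0, k} : Finset ℕ),
        ((PowerSeries.coeff n (1 - PowerSeries.X ^ k : PowerSeries ℝ) : ℝ) : ℂ) * q ^ n = 0 := by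
      intro n hn
      simp only [Finset.mem_insert, Finset.mem_singleton, not_or] at hn
      simp [PowerSeries.coeff_one, PowerSeries.coeff_X_pow, hn.1, hn.2]
    refine ⟨summable_of_ne_finset_zero (s := {0, k}) fun n hn => ?_, ?_⟩
    · rw [h n hn, norm_zero]
    · rw [tsum_eq_sum h, Finset.sum_pair hk.symm]
      simp [PowerSeries.coeff_X_pow, PowerSeries.coeff_one, hk, sub_eq_add_neg]
  have h3 := h1.mul h2
  rw [hG, PowerSeries.inv_mul_cancel _ (by simp [hk])] at h3
  have h4 := h3.2.symm.trans (HasEval.one q).2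
  refine ⟨hs, eq_inv_of_mul_eq_one_left h4⟩

theorem PowerSeries.coeff_mul_nonneg {f g : PowerSeries ℝ} (hf : ∀ n, 0 ≤ PowerSeries.coeff n f)
    (hg : ∀ n, 0 ≤ PowerSeries.coeff n g) (n : ℕ) : 0 ≤ PowerSeries.coeff n (f * g) := by
  rw [PowerSeries.coeff_mul]
  exact Finset.sum_nonneg fun kl _ => mul_nonneg (hf _) (hg _)

theorem PowerSeries.coeff_pow_nonneg {f : PowerSeries ℝ} (hf : ∀ n, 0 ≤ PowerSeries.coeff n f)
    (j n : ℕ) : 0 ≤ PowerSeries.coeff n (f ^ j) := by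
  induction j generalizing n with
  | zero =>
    rw [pow_zero, PowerSeries.coeff_one]
    split_ifs <;> norm_num
  | succ j ih =>
    rw [pow_succ]
    exact PowerSeries.coeff_mul_nonneg ih hf n

/-- A product of power series with nonnegative coefficients and factors `1 + O(X ^ (k + 1))` may be
evaluated factor by factor: the coefficients of the partial products increase to those of the
product, which therefore dominate them. -/
theorem HasEval.tprod {f : ℕ → PowerSeries ℝ} {v : ℕ → ℂ → ℂ} {q V W : ℂ}
    (hX : ∀ k, PowerSeries.X ^ (k + 1) ∣ f k - 1)
    (hpos : ∀ k n, 0 ≤ PowerSeries.coeff n (f k))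
    (hev : ∀ k (q : ℂ), ‖q‖ < 1 → HasEval (f k) q (v k q))
    (hq : ‖q‖ < 1) (hV : Tendsto (fun K => ∏ k ∈ Finset.range K, v k q) atTop (𝓝 V))
    (hW : Tendsto (fun K => ∏ k ∈ Finset.range K, v k (‖q‖ : ℝ)) atTop (𝓝 W)) :
    HasEval (∏' k, f k) q V := by
  set P : ℕ → PowerSeries ℝ := fun K => ∏ k ∈ Finset.range K, f k with hP
  set a : ℕ → ℝ := fun n => PowerSeries.coeff n (∏' k, f k) with ha
  have hlim : ∀ n, Tendsto (fun K => PowerSeries.coeff n (P K)) atTop (𝓝 (a n)) := fun n =>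
    ((PowerSeries.WithPiTopology.continuous_coeff ℝ n).tendsto _).comp
      (multipliable_of_X_pow_dvd f hX).hasProd.tendsto_prod_nat
  have hc0 : ∀ k, PowerSeries.coeff 0 (f k) = 1 := fun k => by
    have := PowerSeries.X_pow_dvd_iff.mp (hX k) 0 (by omega)
    simpa [sub_eq_zero] using this
  have hP0 : ∀ K n, 0 ≤ PowerSeries.coeff n (P K) := by
    intro K
    induction K with
    | zero =>
      intro n
      simp only [hP, Finset.range_zero, Finset.prod_empty, PowerSeries.coeff_one]
      split_ifs <;> norm_num
    | succ K ih =>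
      simp only [hP, Finset.prod_range_succ]
      exact PowerSeries.coeff_mul_nonneg ih (hpos K)
  have hmono : ∀ n, Monotone fun K => PowerSeries.coeff n (P K) := by
    refine fun n => monotone_nat_of_le_succ fun K => ?_
    have : PowerSeries.coeff n (P (K + 1)) = ∑ kl ∈ Finset.HasAntidiagonal.antidiagonal n,
        PowerSeries.coeff kl.1 (P K) * PowerSeries.coeff kl.2 (f K) := by
      simp only [hP, Finset.prod_range_succ, PowerSeries.coeff_mul]
    rw [this]
    have h1 := Finset.single_le_sum (s := Finset.HasAntidiagonal.antidiagonal n)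
      (f := fun kl => PowerSeries.coeff kl.1 (P K) * PowerSeries.coeff kl.2 (f K))
      (fun kl _ => mul_nonneg (hP0 _ _) (hpos _ _)) (a := (n, 0)) (by simp)
    simpa [hc0] using h1
  have hle : ∀ K n, PowerSeries.coeff n (P K) ≤ a n := fun K n => (hmono n).ge_of_tendsto (hlim n) K
  have ha0 : ∀ n, 0 ≤ a n := fun n => (hP0 0 n).trans (hle 0 n)
  have hPev : ∀ K (q : ℂ), ‖q‖ < 1 → HasEval (P K) q (∏ k ∈ Finset.range K, v k q) :=
    fun K q hq => HasEval.prod_range (fun k => hev k q hq) K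
  -- the partial sums of `∑ a n * |q|^n` are bounded by the limit of the products at `|q|`
  have hs : Summable fun n => a n * ‖q‖ ^ n := by
    have hq' : ‖((‖q‖ : ℝ) : ℂ)‖ < 1 := by simpa using hq
    refine summable_of_sum_range_le (c := ‖W‖)
      (fun n => mul_nonneg (ha0 n) (by positivity)) fun N => ?_
    refine le_of_tendsto_of_tendsto
      (tendsto_finsetSum _ fun n _ => (hlim n).mul_const (‖q‖ ^ n)) (hW.norm)
      (Eventually.of_forall fun K => ?_)
    have h1 := hPev K _ hq'
    have h2 : (∑' n, (PowerSeries.coeff n (P K) * ‖q‖ ^ n : ℝ)) =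
        ‖∏ k ∈ Finset.range K, v k ((‖q‖ : ℝ) : ℂ)‖ := by
      rw [← h1.2]
      have : ∑' n, ((PowerSeries.coeff n (P K) : ℝ) : ℂ) * ((‖q‖ : ℝ) : ℂ) ^ n =
          ((∑' n, (PowerSeries.coeff n (P K) * ‖q‖ ^ n : ℝ) : ℝ) : ℂ) := by
        rw [Complex.ofReal_tsum]
        push_cast
        rfl
      rw [this, Complex.norm_real, Real.norm_of_nonneg]
      exact tsum_nonneg fun n => mul_nonneg (hP0 K n) (by positivity)
    simp only [← h2]
    refine Summable.sum_le_tsum _ (fun n _ => mul_nonneg (hP0 K n) (by positivity)) ?_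
    refine h1.1.congr fun n => ?_
    simp [abs_of_nonneg (hP0 K n)]
  refine ⟨hs.congr fun n => ?_, ?_⟩
  · rw [norm_mul, norm_pow, Complex.norm_real, Real.norm_of_nonneg (ha0 n)]
  · refine tendsto_nhds_unique ?_ hV
    have := tendsto_tsum_of_dominated_convergence (𝓕 := atTop)
      (f := fun K n => ((PowerSeries.coeff n (P K) : ℝ) : ℂ) * q ^ n)
      (g := fun n => (a n : ℂ) * q ^ n) hs
      (fun n => ((Complex.continuous_ofReal.tendsto _).comp (hlim n)).mul_const _)
      (Eventually.of_forall fun K n => by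
        rw [norm_mul, norm_pow, Complex.norm_real, Real.norm_of_nonneg (hP0 K n)]
        gcongr
        exact hle K n)
    exact this.congr fun K => (hPev K q hq).2

theorem coeff_one_add_X_pow_nonneg (k n : ℕ) :
    0 ≤ PowerSeries.coeff n (1 + PowerSeries.X ^ k : PowerSeries ℝ) := by
  rw [map_add, PowerSeries.coeff_one, PowerSeries.coeff_X_pow]
  split_ifs <;> norm_num

theorem coeff_inv_one_sub_X_pow_nonneg {k : ℕ} (hk : k ≠ 0) (n : ℕ) :
    0 ≤ PowerSeries.coeff n ((1 - PowerSeries.X ^ k : PowerSeries ℝ)⁻¹) := by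
  rw [inv_one_sub_X_pow hk, PowerSeries.coeff_mk]
  split_ifs <;> norm_num

/-! ### The logarithm of MacMahon's product -/

theorem norm_exp_neg_lt_one {z : ℂ} (hz : 0 < z.re) : ‖Complex.exp (-z)‖ < 1 := by
  rw [Complex.norm_exp, Complex.neg_re, Real.exp_lt_one_iff]
  linarith

theorem one_sub_exp_neg_ne_zero {z : ℂ} (hz : 0 < z.re) : 1 - Complex.exp (-z) ≠ 0 := by
  intro h
  have := norm_exp_neg_lt_one hz
  rw [← sub_eq_zero.mp h, norm_one] at this
  exact lt_irrefl _ this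

theorem natCast_add_one_mul_re_pos {z : ℂ} (hz : 0 < z.re) (k : ℕ) :
    0 < (((k : ℂ) + 1) * z).re := by
  have : (((k : ℂ) + 1) * z).re = ((k : ℝ) + 1) * z.re := by simp
  rw [this]
  positivity

theorem norm_log_one_sub_exp_neg_le {z : ℂ} (hz : 0 < z.re) :
    ‖Complex.log (1 - Complex.exp (-z))‖ ≤ ‖Complex.exp (-z)‖ / (1 - ‖Complex.exp (-z)‖) := by
  have hw := norm_exp_neg_lt_one hz
  set w := Complex.exp (-z)
  have h := Complex.norm_log_one_add_le (z := -w) (by rwa [norm_neg])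
  rw [norm_neg, ← sub_eq_add_neg] at h
  refine h.trans ?_
  have h1 : 0 < 1 - ‖w‖ := by linarith
  have h0 := norm_nonneg w
  rw [le_div_iff₀ h1]
  field_simp
  nlinarith

/-- `∑ k ≥ 1, -k log (1 - e^(-kz))`, the logarithm of MacMahon's product `∏ (1 - q^k)^(-k)` at
`q = e^(-z)`. The sum converges for `0 < Re z`. -/
noncomputable def logMacMahon (z : ℂ) : ℂ :=
  ∑' k : ℕ, -(((k : ℂ) + 1) * Complex.log (1 - Complex.exp (-(((k : ℂ) + 1) * z))))

theorem summable_logMacMahon {z : ℂ} (hz : 0 < z.re) : Summable fun k : ℕ =>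
    -(((k : ℂ) + 1) * Complex.log (1 - Complex.exp (-(((k : ℂ) + 1) * z)))) := by
  set r := ‖Complex.exp (-z)‖ with hr
  have hr1 : r < 1 := norm_exp_neg_lt_one hz
  have hr0 : 0 ≤ r := norm_nonneg _
  have hs : Summable fun k : ℕ => ((k + 1 : ℕ) : ℝ) ^ 1 * r ^ (k + 1) :=
    (summable_nat_add_iff (f := fun k : ℕ => (k : ℝ) ^ 1 * r ^ k) 1).mpr
      (summable_pow_mul_geometric_of_norm_lt_one 1 (by rwa [Real.norm_of_nonneg hr0]))
  refine Summable.of_norm_bounded (hs.mul_right (1 - r)⁻¹) fun k => ?_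
  have hk : Complex.exp (-(((k : ℂ) + 1) * z)) = Complex.exp (-z) ^ (k + 1) := by
    rw [← Complex.exp_nat_mul]
    push_cast
    ring_nf
  have h1 : ‖Complex.exp (-(((k : ℂ) + 1) * z))‖ = r ^ (k + 1) := by rw [hk, norm_pow]
  have h2 := norm_log_one_sub_exp_neg_le (natCast_add_one_mul_re_pos hz k)
  have h3 : ‖(k : ℂ) + 1‖ = ((k + 1 : ℕ) : ℝ) := by
    rw [← Complex.norm_natCast]; push_cast; rfl
  rw [norm_neg, norm_mul, h3, pow_one, mul_assoc, ← div_eq_mul_inv]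
  rw [h1] at h2
  have h4 : r ^ (k + 1) ≤ r := pow_le_of_le_one hr0 hr1.le (by omega)
  have h5 : 0 < 1 - r := by linarith
  have h6 : r ^ (k + 1) / (1 - r ^ (k + 1)) ≤ r ^ (k + 1) / (1 - r) := by gcongr
  gcongr
  exact h2.trans h6

theorem tendsto_prod_inv_one_sub_exp (m : ℕ) {z : ℂ} (hz : 0 < z.re) :
    Tendsto (fun K => ∏ k ∈ Finset.range K,
      ((1 - Complex.exp (-z) ^ (k + 1))⁻¹) ^ (m * (k + 1))) atTop
      (𝓝 (Complex.exp (m * logMacMahon z))) := by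
  have h := ((summable_logMacMahon hz).hasSum.tendsto_sum_nat.const_mul (m : ℂ)).cexp
  refine h.congr fun K => ?_
  rw [Finset.mul_sum, Complex.exp_sum]
  refine Finset.prod_congr rfl fun k _ => ?_
  have hk : Complex.exp (-(((k : ℂ) + 1) * z)) = Complex.exp (-z) ^ (k + 1) := by
    rw [← Complex.exp_nat_mul]
    push_cast
    ring_nf
  have h0 := one_sub_exp_neg_ne_zero (natCast_add_one_mul_re_pos hz k)
  rw [hk] at h0 ⊢
  rw [show (m : ℂ) * -(((k : ℂ) + 1) * Complex.log (1 - Complex.exp (-z) ^ (k + 1))) =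
    ((m * (k + 1) : ℕ) : ℂ) * -Complex.log (1 - Complex.exp (-z) ^ (k + 1)) by push_cast; ring,
    Complex.exp_nat_mul, Complex.exp_neg, Complex.exp_log h0]

theorem tendsto_prod_one_add_exp (m : ℕ) {z : ℂ} (hz : 0 < z.re) :
    Tendsto (fun K => ∏ k ∈ Finset.range K, (1 + Complex.exp (-z) ^ (k + 1)) ^ (m * (k + 1))) atTop
      (𝓝 (Complex.exp (m * (logMacMahon z - logMacMahon (2 * z))))) := by
  have hz2 : 0 < (2 * z).re := by simpa using hz
  have h := (tendsto_prod_inv_one_sub_exp m hz).div (tendsto_prod_inv_one_sub_exp m hz2)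
    (Complex.exp_ne_zero _)
  rw [← Complex.exp_sub, ← mul_sub] at h
  refine h.congr fun K => ?_
  rw [Pi.div_apply, ← Finset.prod_div_distrib]
  refine Finset.prod_congr rfl fun k _ => ?_
  have hk : ∀ z : ℂ, Complex.exp (-z) ^ (k + 1) = Complex.exp (-(((k : ℂ) + 1) * z)) := fun z => by
    rw [← Complex.exp_nat_mul]
    push_cast
    ring_nf
  have h0 := one_sub_exp_neg_ne_zero (natCast_add_one_mul_re_pos hz k)
  have h1 := one_sub_exp_neg_ne_zero (natCast_add_one_mul_re_pos hz2 k)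
  rw [← div_pow, hk, hk]
  congr 1
  have h2 : Complex.exp (-(((k : ℂ) + 1) * (2 * z))) = Complex.exp (-(((k : ℂ) + 1) * z)) ^ 2 := by
    rw [← Complex.exp_nat_mul]
    push_cast
    ring_nf
  rw [h2] at h1 ⊢
  field_simp
  ring

theorem tendsto_prod_ratio_exp (m : ℕ) {z : ℂ} (hz : 0 < z.re) :
    Tendsto (fun K => ∏ k ∈ Finset.range K, ((1 + Complex.exp (-z) ^ (k + 1)) *
      (1 - Complex.exp (-z) ^ (k + 1))⁻¹) ^ (m * (k + 1))) atTop
      (𝓝 (Complex.exp (m * (2 * logMacMahon z - logMacMahon (2 * z))))) := by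
  have h := (tendsto_prod_one_add_exp m hz).mul (tendsto_prod_inv_one_sub_exp m hz)
  rw [← Complex.exp_add, ← mul_add] at h
  convert h using 2
  · rw [← Finset.prod_mul_distrib]
    simp only [mul_pow]
  · ring_nf

/-! ### Euler–Maclaurin summation and the Glaisher–Kinkelin constant -/

/-- The kernel `B₃(s) / 6` of the Euler–Maclaurin formula, `B₃` being the third Bernoulli
polynomial. -/
noncomputable def emKernel (s : ℝ) : ℝ := s ^ 3 / 6 - s ^ 2 / 4 + s / 12

theorem abs_emKernel_le_one {s : ℝ} (h0 : 0 ≤ s) (h1 : s ≤ 1) : |emKernel s| ≤ 1 := by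
  have h2 : s ^ 2 ≤ 1 := by nlinarith
  have h3 : s ^ 3 ≤ 1 := by nlinarith [sq_nonneg s]
  have h4 : 0 ≤ s ^ 2 := sq_nonneg s
  have h5 : 0 ≤ s ^ 3 := by positivity
  rw [abs_le, emKernel]
  constructor <;> linarith

theorem continuous_emKernel : Continuous emKernel := by
  unfold emKernel
  fun_prop

/-- The Euler–Maclaurin formula with third-order remainder on a unit interval. -/
theorem integral_emKernel_mul {f f₁ f₂ f₃ : ℝ → ℂ} (hf : ∀ x > 0, HasDerivAt f (f₁ x) x)
    (hf₁ : ∀ x > 0, HasDerivAt f₁ (f₂ x) x) (hf₂ : ∀ x > 0, HasDerivAt f₂ (f₃ x) x)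
    (hf₃ : ContinuousOn f₃ (Set.Ioi 0)) {a : ℝ} (ha : 0 < a) :
    ∫ s in (0 : ℝ)..1, (emKernel s : ℂ) * f₃ (a + s) =
      (f a + f (a + 1)) / 2 - (f₁ (a + 1) - f₁ a) / 12 - ∫ x in a..(a + 1), f x := by
  have hpos : ∀ s ∈ Set.uIcc (0 : ℝ) 1, a + s ∈ Set.Ioi 0 := fun s hs => by
    rw [Set.uIcc_of_le zero_le_one] at hs
    have := hs.1
    simp only [Set.mem_Ioi]
    linarith
  have hsh : ContinuousOn (fun s : ℝ => a + s) (Set.uIcc 0 1) := by fun_prop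
  have hfc : ContinuousOn f (Set.Ioi 0) := fun x hx => (hf x hx).continuousAt.continuousWithinAt
  have hc3 : ContinuousOn (fun s => (emKernel s : ℂ) * f₃ (a + s)) (Set.uIcc 0 1) :=
    (Complex.continuous_ofReal.comp continuous_emKernel).continuousOn.mul (hf₃.comp hsh hpos)
  have hc0 : ContinuousOn (fun s => f (a + s)) (Set.uIcc 0 1) := hfc.comp hsh hpos
  -- an antiderivative of `K f₃ + f`, as the third derivative of the kernel `K` is `1`
  have hG : ∀ s ∈ Set.uIcc (0 : ℝ) 1, HasDerivAt (fun s : ℝ => (emKernel s : ℂ) * f₂ (a + s)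
      - ((s ^ 2 / 2 - s / 2 + 1 / 12 : ℝ) : ℂ) * f₁ (a + s) + ((s - 1 / 2 : ℝ) : ℂ) * f (a + s))
      ((emKernel s : ℂ) * f₃ (a + s) + f (a + s)) s := by
    intro s hs
    have hs' := hpos s hs
    have e0 : HasDerivAt (fun s => f (a + s)) (f₁ (a + s)) s := (hf _ hs').comp_const_add a s
    have e1 : HasDerivAt (fun s => f₁ (a + s)) (f₂ (a + s)) s := (hf₁ _ hs').comp_const_add a s
    have e2 : HasDerivAt (fun s => f₂ (a + s)) (f₃ (a + s)) s := (hf₂ _ hs').comp_const_add a s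
    have k0 : HasDerivAt (fun s => (emKernel s : ℂ)) ((s ^ 2 / 2 - s / 2 + 1 / 12 : ℝ) : ℂ) s := by
      refine HasDerivAt.ofReal_comp ?_
      have := (((hasDerivAt_pow 3 s).div_const 6).sub ((hasDerivAt_pow 2 s).div_const 4)).add
        ((hasDerivAt_id s).div_const 12)
      exact this.congr_deriv (by push_cast; ring)
    have k1 : HasDerivAt (fun s : ℝ => ((s ^ 2 / 2 - s / 2 + 1 / 12 : ℝ) : ℂ))
        ((s - 1 / 2 : ℝ) : ℂ) s := by
      refine HasDerivAt.ofReal_comp ?_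
      have := (((hasDerivAt_pow 2 s).div_const 2).sub ((hasDerivAt_id s).div_const 2)).add_const
        (1 / 12)
      exact this.congr_deriv (by push_cast; ring)
    have k2 : HasDerivAt (fun s : ℝ => ((s - 1 / 2 : ℝ) : ℂ)) ((1 : ℝ) : ℂ) s :=
      HasDerivAt.ofReal_comp ((hasDerivAt_id s).sub_const (1 / 2))
    exact (((k0.mul e2).sub (k1.mul e1)).add (k2.mul e0)).congr_deriv (by push_cast; ring)
  have h1 := intervalIntegral.integral_eq_sub_of_hasDerivAt hG
    (hc3.intervalIntegrable.add hc0.intervalIntegrable)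
  rw [intervalIntegral.integral_add hc3.intervalIntegrable hc0.intervalIntegrable,
    intervalIntegral.integral_comp_add_left (fun x => f x) a, add_zero] at h1
  rw [eq_sub_iff_add_eq, h1]
  simp only [emKernel]
  push_cast
  ring_nf

/-- The Euler–Maclaurin formula on `[1, N + 1]`. -/
theorem sum_integral_emKernel_mul {f f₁ f₂ f₃ : ℝ → ℂ} (hf : ∀ x > 0, HasDerivAt f (f₁ x) x)
    (hf₁ : ∀ x > 0, HasDerivAt f₁ (f₂ x) x) (hf₂ : ∀ x > 0, HasDerivAt f₂ (f₃ x) x)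
    (hf₃ : ContinuousOn f₃ (Set.Ioi 0)) (N : ℕ) :
    ∑ k ∈ Finset.range N, ∫ s in (0 : ℝ)..1, (emKernel s : ℂ) * f₃ (((k : ℝ) + 1) + s) =
      ∑ k ∈ Finset.range N, f ((k : ℝ) + 1) + (f ((N : ℝ) + 1) - f 1) / 2
        - (f₁ ((N : ℝ) + 1) - f₁ 1) / 12 - ∫ x in (1 : ℝ)..((N : ℝ) + 1), f x := by
  induction N with
  | zero => simp
  | succ N ih =>
    have hfi : ∀ a b : ℝ, 0 < a → 0 < b → IntervalIntegrable f MeasureTheory.volume a b :=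
      fun a b ha hb => ContinuousOn.intervalIntegrable fun x hx => by
        have : 0 < x := (lt_min ha hb).trans_le hx.1
        exact (hf x this).continuousAt.continuousWithinAt
    have hN : (0 : ℝ) < (N : ℝ) + 1 := by positivity
    rw [Finset.sum_range_succ, Finset.sum_range_succ, ih, integral_emKernel_mul hf hf₁ hf₂ hf₃ hN]
    push_cast
    rw [← intervalIntegral.integral_add_adjacent_intervals (hfi 1 _ one_pos hN)
      (hfi _ ((N : ℝ) + 1 + 1) hN (by positivity))]
    ring

theorem log_glaisherSeq {n : ℕ} (hn : 0 < n) : Real.log (glaisherSeq n) =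
    ∑ k ∈ Finset.range n, ((k : ℝ) + 1) * Real.log ((k : ℝ) + 1)
      - (((n : ℝ) ^ 2 / 2 + (n : ℝ) / 2 + 1 / 12) * Real.log n - (n : ℝ) ^ 2 / 4) := by
  have hn' : (0 : ℝ) < n := by exact_mod_cast hn
  have hp : ∏ k ∈ Finset.Icc 1 n, (k : ℝ) ^ k =
      ∏ k ∈ Finset.range n, ((k : ℝ) + 1) ^ (k + 1) := by
    rw [Finset.range_eq_Ico, ← Finset.Ico_add_one_right_eq_Icc,
      ← Finset.prod_Ico_add' (fun k : ℕ => (k : ℝ) ^ k) 0 n 1]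
    push_cast
    rfl
  have hp0 : 0 < ∏ k ∈ Finset.range n, ((k : ℝ) + 1) ^ (k + 1) :=
    Finset.prod_pos fun k _ => by positivity
  rw [glaisherSeq, hp, Real.log_div hp0.ne' (by positivity),
    Real.log_mul (by positivity) (Real.exp_pos _).ne', Real.log_rpow hn', Real.log_exp,
    Real.log_prod fun k _ => by positivity]
  simp only [Real.log_pow]
  push_cast
  ring

/-- The Euler–Maclaurin remainders of `x log x` add up to `log A - 1 / 4`. -/
theorem tendsto_sum_integral_emKernel_neg_inv_sq :
    Tendsto (fun N => ∑ k ∈ Finset.range N, ∫ s in (0 : ℝ)..1,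
      (emKernel s : ℂ) * ((-(1 / (((k : ℝ) + 1) + s) ^ 2) : ℝ) : ℂ)) atTop
      (𝓝 ((Real.log glaisherKinkelin - 1 / 4 : ℝ) : ℂ)) := by
  have d0 : ∀ x > 0, HasDerivAt (fun x : ℝ => ((x * Real.log x : ℝ) : ℂ))
      ((Real.log x + 1 : ℝ) : ℂ) x := fun x hx =>
    HasDerivAt.ofReal_comp (Real.hasDerivAt_mul_log (ne_of_gt hx))
  have d1 : ∀ x > 0, HasDerivAt (fun x : ℝ => ((Real.log x + 1 : ℝ) : ℂ))
      ((x⁻¹ : ℝ) : ℂ) x := fun x hx =>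
    HasDerivAt.ofReal_comp ((Real.hasDerivAt_log (ne_of_gt hx)).add_const 1)
  have d2 : ∀ x > 0, HasDerivAt (fun x : ℝ => ((x⁻¹ : ℝ) : ℂ))
      ((-(1 / x ^ 2) : ℝ) : ℂ) x := fun x hx =>
    HasDerivAt.ofReal_comp (by simpa using hasDerivAt_inv (ne_of_gt hx))
  have c3 : ContinuousOn (fun x : ℝ => ((-(1 / x ^ 2) : ℝ) : ℂ)) (Set.Ioi 0) := by
    refine Complex.continuous_ofReal.comp_continuousOn ?_
    refine (continuousOn_const.div (by fun_prop) fun x hx => ?_).neg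
    exact pow_ne_zero _ (ne_of_gt hx)
  have key : ∀ N : ℕ, ∑ k ∈ Finset.range N, ∫ s in (0 : ℝ)..1,
      (emKernel s : ℂ) * ((-(1 / (((k : ℝ) + 1) + s) ^ 2) : ℝ) : ℂ) =
      ((Real.log (glaisherSeq (N + 1)) - 1 / 4 : ℝ) : ℂ) := by
    intro N
    have hN : (0 : ℝ) < (N : ℝ) + 1 := by positivity
    have hint : ∫ x in (1 : ℝ)..((N : ℝ) + 1), x * Real.log x =
        ((N : ℝ) + 1) ^ 2 / 2 * Real.log ((N : ℝ) + 1) - ((N : ℝ) + 1) ^ 2 / 4 + 1 / 4 := by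
      rw [intervalIntegral.integral_eq_sub_of_hasDerivAt
        (f := fun x => x ^ 2 / 2 * Real.log x - x ^ 2 / 4)]
      · simp
      · intro x hx
        have hx0 : x ≠ 0 := by
          have : (0 : ℝ) < x := (lt_min one_pos hN).trans_le hx.1
          exact this.ne'
        have := (((hasDerivAt_pow 2 x).div_const 2).mul (Real.hasDerivAt_log hx0)).sub
          ((hasDerivAt_pow 2 x).div_const 4)
        refine this.congr_deriv ?_
        push_cast
        field_simp
        ring
      · exact Real.continuous_mul_log.intervalIntegrable _ _
    rw [sum_integral_emKernel_mul d0 d1 d2 c3, intervalIntegral.integral_ofReal, hint,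
      log_glaisherSeq N.succ_pos, Finset.sum_range_succ]
    push_cast
    simp
    ring
  simp only [key]
  have := tendsto_glaisherSeq.comp (tendsto_add_atTop_nat 1)
  exact (Complex.continuous_ofReal.tendsto _).comp
    ((this.log glaisherKinkelin_pos.ne').sub_const (1 / 4))

/-! ### The summand and its derivatives -/

/-- The inequality `y / 2 ≤ sinh (y / 2)`, in terms of `e^(-y)`. -/
theorem mul_exp_neg_half_le {y : ℝ} (hy : 0 ≤ y) : y * Real.exp (-y / 2) ≤ 1 - Real.exp (-y) := by
  have h := Real.self_le_sinh_iff.mpr (show 0 ≤ y / 2 by linarith)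
  rw [Real.sinh_eq] at h
  have e1 : Real.exp (-y) = Real.exp (-y / 2) * Real.exp (-(y / 2)) := by
    rw [← Real.exp_add]; ring_nf
  have e2 : Real.exp (-y / 2) * Real.exp (y / 2) = 1 := by
    rw [← Real.exp_add]; ring_nf; exact Real.exp_zero
  have h0 := Real.exp_pos (-y / 2)
  rw [e1]
  nlinarith

theorem exp_neg_div_one_sub_le {y : ℝ} (hy : 0 < y) :
    Real.exp (-y) / (1 - Real.exp (-y)) ≤ Real.exp (-y / 2) / y := by
  have h := mul_exp_neg_half_le hy.le
  have h0 := Real.exp_pos (-y / 2)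
  have e1 : Real.exp (-y) = Real.exp (-y / 2) * Real.exp (-y / 2) := by
    rw [← Real.exp_add]; ring_nf
  rw [div_le_div_iff₀ (by nlinarith) hy]
  nlinarith

theorem exp_neg_div_one_sub_sq_le {y : ℝ} (hy : 0 < y) :
    Real.exp (-y) / (1 - Real.exp (-y)) ^ 2 ≤ 1 / y ^ 2 := by
  have h := mul_exp_neg_half_le hy.le
  have h0 := Real.exp_pos (-y / 2)
  have e1 : Real.exp (-y) = Real.exp (-y / 2) ^ 2 := by
    rw [sq, ← Real.exp_add]; ring_nf
  have h1 : 0 < y * Real.exp (-y / 2) := by positivity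
  rw [div_le_div_iff₀ (by nlinarith) (by positivity)]
  calc Real.exp (-y) * y ^ 2 = (y * Real.exp (-y / 2)) ^ 2 := by rw [e1]; ring
    _ ≤ (1 - Real.exp (-y)) ^ 2 := by gcongr
    _ = _ := by ring

/-- In terms of `x = y / 2` this is `x³ cosh x ≤ 2 sinh³ x`, a consequence of `x ≤ sinh x` and
`x cosh (x / 2) ≤ sinh x`. -/
theorem exp_neg_mul_div_one_sub_cube_le {y : ℝ} (hy : 0 < y) :
    Real.exp (-y) * (1 + Real.exp (-y)) / (1 - Real.exp (-y)) ^ 3 ≤ 4 / y ^ 3 := by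
  have h := mul_exp_neg_half_le hy.le
  have h' := mul_exp_neg_half_le (show 0 ≤ y / 2 by linarith)
  set a := Real.exp (-(y / 2) / 2) with ha
  have ha0 : 0 < a := Real.exp_pos _
  have e1 : Real.exp (-(y / 2)) = a ^ 2 := by rw [sq, ← Real.exp_add]; ring_nf
  have e2 : Real.exp (-y) = a ^ 4 := by rw [← Real.exp_nat_mul]; push_cast; ring_nf
  have e3 : Real.exp (-y / 2) = a ^ 2 := by rw [sq, ← Real.exp_add]; ring_nf
  rw [e2, e3] at h
  rw [e1] at h'
  rw [e2]
  have h1 : 0 < 1 - a ^ 4 := lt_of_lt_of_le (by positivity) h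
  -- `1 - e^(-y) = (1 - e^(-y/2)) (1 + e^(-y/2))`
  have h2 : y / 2 * a * (1 + a ^ 2) ≤ 1 - a ^ 4 := by nlinarith [sq_nonneg a]
  have h3 : (y / 2 * a * (1 + a ^ 2)) ^ 2 ≤ (1 - a ^ 4) ^ 2 := by gcongr
  have h4 : y ^ 2 / 4 * a ^ 2 * (1 + a ^ 4) ≤ (1 - a ^ 4) ^ 2 := by
    refine le_trans ?_ h3
    have : 0 ≤ y ^ 2 / 4 * a ^ 2 * (2 * a ^ 2) := by positivity
    nlinarith
  rw [div_le_div_iff₀ (by positivity) (by positivity)]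
  calc a ^ 4 * (1 + a ^ 4) * y ^ 3 = 4 * ((y ^ 2 / 4 * a ^ 2 * (1 + a ^ 4)) * (y * a ^ 2)) := by
        ring
    _ ≤ 4 * ((1 - a ^ 4) ^ 2 * (1 - a ^ 4)) := by gcongr
    _ = _ := by ring

/-- The function `x ↦ -x log (1 - e^(-xz))`, whose values at the positive integers are the terms of
`logMacMahon z`. -/
noncomputable def macTerm (z : ℂ) (x : ℝ) : ℂ := -(x * Complex.log (1 - Complex.exp (-(x * z))))

/-- The first derivative of `macTerm z`. -/
noncomputable def macTerm₁ (z : ℂ) (x : ℝ) : ℂ :=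
  -Complex.log (1 - Complex.exp (-(x * z)))
    - x * z * (Complex.exp (-(x * z)) / (1 - Complex.exp (-(x * z))))

/-- The second derivative of `macTerm z`. -/
noncomputable def macTerm₂ (z : ℂ) (x : ℝ) : ℂ :=
  -2 * z * (Complex.exp (-(x * z)) / (1 - Complex.exp (-(x * z))))
    + x * z ^ 2 * (Complex.exp (-(x * z)) / (1 - Complex.exp (-(x * z))) ^ 2)

/-- The third derivative of `macTerm z`. -/
noncomputable def macTerm₃ (z : ℂ) (x : ℝ) : ℂ :=
  3 * z ^ 2 * (Complex.exp (-(x * z)) / (1 - Complex.exp (-(x * z))) ^ 2)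
    - x * z ^ 3 * (Complex.exp (-(x * z)) * (1 + Complex.exp (-(x * z))) /
      (1 - Complex.exp (-(x * z))) ^ 3)

theorem ofReal_mul_re_pos {z : ℂ} (hz : 0 < z.re) {x : ℝ} (hx : 0 < x) : 0 < ((x : ℂ) * z).re := by
  rw [Complex.re_ofReal_mul]
  positivity

theorem one_sub_exp_neg_mem_slitPlane {w : ℂ} (hw : 0 < w.re) :
    1 - Complex.exp (-w) ∈ Complex.slitPlane := by
  left
  have := Complex.re_le_norm (Complex.exp (-w))
  have := norm_exp_neg_lt_one hw
  rw [Complex.sub_re, Complex.one_re]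
  linarith

theorem hasDerivAt_exp_neg_mul (z : ℂ) (x : ℝ) :
    HasDerivAt (fun x : ℝ => Complex.exp (-(x * z))) (-z * Complex.exp (-(x * z))) x := by
  have h : HasDerivAt (fun x : ℝ => -((x : ℂ) * z)) (-z) x := by
    exact ((hasDerivAt_id x).ofReal_comp.mul_const z).neg.congr_deriv (by simp)
  exact h.cexp.congr_deriv (by ring)

theorem hasDerivAt_macTerm {z : ℂ} (hz : 0 < z.re) {x : ℝ} (hx : 0 < x) :
    HasDerivAt (macTerm z) (macTerm₁ z x) x := by
  have he := (hasDerivAt_exp_neg_mul z x).const_sub 1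
  have hx' := ofReal_mul_re_pos hz hx
  have hl := he.clog_real (one_sub_exp_neg_mem_slitPlane hx')
  refine (((hasDerivAt_id x).ofReal_comp.mul hl).neg).congr_deriv ?_
  simp only [macTerm₁, id, Complex.ofReal_one]
  ring

theorem hasDerivAt_exp_neg_div {z : ℂ} (hz : 0 < z.re) {x : ℝ} (hx : 0 < x) :
    HasDerivAt (fun x : ℝ => Complex.exp (-(x * z)) / (1 - Complex.exp (-(x * z))))
      (-z * (Complex.exp (-(x * z)) / (1 - Complex.exp (-(x * z))) ^ 2)) x := by
  have he := hasDerivAt_exp_neg_mul z x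
  have h0 := one_sub_exp_neg_ne_zero (ofReal_mul_re_pos hz hx)
  refine (he.div (he.const_sub 1) h0).congr_deriv ?_
  field_simp
  ring

theorem hasDerivAt_macTerm₁ {z : ℂ} (hz : 0 < z.re) {x : ℝ} (hx : 0 < x) :
    HasDerivAt (macTerm₁ z) (macTerm₂ z x) x := by
  have he := (hasDerivAt_exp_neg_mul z x).const_sub 1
  have hx' := ofReal_mul_re_pos hz hx
  have h0 := one_sub_exp_neg_ne_zero hx'
  have hl := he.clog_real (one_sub_exp_neg_mem_slitPlane hx')
  refine (hl.neg.sub (((hasDerivAt_id x).ofReal_comp.mul_const z).mul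
    (hasDerivAt_exp_neg_div hz hx))).congr_deriv ?_
  simp only [macTerm₂, id, Complex.ofReal_one]
  field_simp
  ring

theorem hasDerivAt_macTerm₂ {z : ℂ} (hz : 0 < z.re) {x : ℝ} (hx : 0 < x) :
    HasDerivAt (macTerm₂ z) (macTerm₃ z x) x := by
  have he := hasDerivAt_exp_neg_mul z x
  have h0 := one_sub_exp_neg_ne_zero (ofReal_mul_re_pos hz hx)
  refine (((hasDerivAt_exp_neg_div hz hx).const_mul (-2 * z)).add
    (((hasDerivAt_id x).ofReal_comp.mul_const (z ^ 2)).mul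
      (he.div ((he.const_sub 1).pow 2) (pow_ne_zero 2 h0)))).congr_deriv ?_
  simp only [macTerm₃, id, Complex.ofReal_one, Pi.pow_apply, Pi.div_apply]
  generalize Complex.exp (-(x * z)) = e at h0 ⊢
  field_simp
  ring

theorem continuousOn_macTerm₃ {z : ℂ} (hz : 0 < z.re) : ContinuousOn (macTerm₃ z) (Set.Ioi 0) := by
  have he : ContinuousOn (fun x : ℝ => Complex.exp (-(x * z))) (Set.Ioi 0) := by fun_prop
  have h0 : ∀ x ∈ Set.Ioi (0 : ℝ), 1 - Complex.exp (-(x * z)) ≠ 0 := fun x hx =>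
    one_sub_exp_neg_ne_zero (ofReal_mul_re_pos hz hx)
  unfold macTerm₃
  refine ContinuousOn.sub (continuousOn_const.mul (he.div ((continuousOn_const.sub he).pow 2)
    fun x hx => pow_ne_zero _ (h0 x hx))) (ContinuousOn.mul (by fun_prop) ?_)
  exact (he.mul (continuousOn_const.add he)).div ((continuousOn_const.sub he).pow 3)
    fun x hx => pow_ne_zero _ (h0 x hx)

theorem norm_exp_neg_eq (z : ℂ) : ‖Complex.exp (-z)‖ = Real.exp (-z.re) := by
  rw [Complex.norm_exp, Complex.neg_re]

theorem one_sub_exp_neg_re_le (z : ℂ) : 1 - Real.exp (-z.re) ≤ ‖1 - Complex.exp (-z)‖ := by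
  have h := norm_sub_norm_le 1 (Complex.exp (-z))
  rwa [norm_one, Complex.norm_exp, Complex.neg_re] at h

theorem norm_exp_neg_div_le {z : ℂ} (hz : 0 < z.re) :
    ‖Complex.exp (-z) / (1 - Complex.exp (-z))‖ ≤ Real.exp (-z.re / 2) / z.re := by
  have h := one_sub_exp_neg_re_le z
  have h1 : 0 < 1 - Real.exp (-z.re) := by
    rw [sub_pos, Real.exp_lt_one_iff]
    linarith
  refine le_trans ?_ (exp_neg_div_one_sub_le hz)
  rw [norm_div, norm_exp_neg_eq z]
  gcongr

theorem norm_exp_neg_div_sq_le {z : ℂ} (hz : 0 < z.re) :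
    ‖Complex.exp (-z) / (1 - Complex.exp (-z)) ^ 2‖ ≤ 1 / z.re ^ 2 := by
  have h := one_sub_exp_neg_re_le z
  have h1 : 0 < 1 - Real.exp (-z.re) := by
    rw [sub_pos, Real.exp_lt_one_iff]
    linarith
  refine le_trans ?_ (exp_neg_div_one_sub_sq_le hz)
  rw [norm_div, norm_pow, norm_exp_neg_eq z]
  gcongr

theorem norm_exp_neg_div_cube_le {z : ℂ} (hz : 0 < z.re) :
    ‖Complex.exp (-z) * (1 + Complex.exp (-z)) / (1 - Complex.exp (-z)) ^ 3‖ ≤ 4 / z.re ^ 3 := by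
  have h := one_sub_exp_neg_re_le z
  have h1 : 0 < 1 - Real.exp (-z.re) := by
    rw [sub_pos, Real.exp_lt_one_iff]
    linarith
  have h2 : ‖1 + Complex.exp (-z)‖ ≤ 1 + Real.exp (-z.re) := by
    refine (norm_add_le _ _).trans ?_
    rw [norm_one, norm_exp_neg_eq z]
  refine le_trans ?_ (exp_neg_mul_div_one_sub_cube_le hz)
  rw [norm_div, norm_mul, norm_pow, norm_exp_neg_eq z]
  gcongr

theorem norm_log_one_sub_exp_neg_le_exp {z : ℂ} (hz : 0 < z.re) :
    ‖Complex.log (1 - Complex.exp (-z))‖ ≤ Real.exp (-z.re / 2) / z.re := by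
  refine (norm_log_one_sub_exp_neg_le hz).trans ?_
  rw [norm_exp_neg_eq z]
  exact exp_neg_div_one_sub_le hz

theorem norm_macTerm_le {z : ℂ} (hz : 0 < z.re) {x : ℝ} (hx : 0 < x) :
    ‖macTerm z x‖ ≤ Real.exp (-(z.re / 2) * x) / z.re := by
  have h := norm_log_one_sub_exp_neg_le_exp (ofReal_mul_re_pos hz hx)
  rw [Complex.re_ofReal_mul] at h
  rw [macTerm, norm_neg, norm_mul, Complex.norm_real, Real.norm_of_nonneg hx.le]
  calc _ ≤ x * (Real.exp (-(x * z.re) / 2) / (x * z.re)) := by gcongr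
    _ = _ := by
      field_simp

theorem norm_macTerm₁_le {z : ℂ} (hz : 0 < z.re) {x : ℝ} (hx : 1 ≤ x) :
    ‖macTerm₁ z x‖ ≤ (1 + ‖z‖) * Real.exp (-(z.re / 2) * x) / z.re := by
  have hx0 : 0 < x := by linarith
  have hw := ofReal_mul_re_pos hz hx0
  have h1 := norm_log_one_sub_exp_neg_le_exp hw
  have h2 := norm_exp_neg_div_le hw
  rw [Complex.re_ofReal_mul] at h1 h2
  refine (norm_sub_le _ _).trans ?_
  rw [norm_neg, norm_mul, norm_mul, Complex.norm_real, Real.norm_of_nonneg hx0.le]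
  have h3 : Real.exp (-(x * z.re) / 2) / (x * z.re) ≤ Real.exp (-(x * z.re) / 2) / z.re := by
    gcongr
    nlinarith
  calc _ ≤ Real.exp (-(x * z.re) / 2) / z.re
        + x * ‖z‖ * (Real.exp (-(x * z.re) / 2) / (x * z.re)) := by
        gcongr
        exact h1.trans h3
    _ = _ := by
      field_simp

/-- In the sector `|z| ≤ 2 Re z` the third derivative is bounded independently of `z`. -/
theorem norm_macTerm₃_le {z : ℂ} (hz : 0 < z.re) (hz2 : ‖z‖ ≤ 2 * z.re) {x : ℝ} (hx : 0 < x) :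
    ‖macTerm₃ z x‖ ≤ 44 / x ^ 2 := by
  have hw := ofReal_mul_re_pos hz hx
  have h2 := norm_exp_neg_div_sq_le hw
  have h3 := norm_exp_neg_div_cube_le hw
  rw [Complex.re_ofReal_mul] at h2 h3
  refine (norm_sub_le _ _).trans ?_
  rw [norm_mul, norm_mul, norm_mul (_ * _), norm_mul (x : ℂ), norm_pow, norm_pow, Complex.norm_real,
    Real.norm_of_nonneg hx.le]
  calc _ ≤ ‖(3 : ℂ)‖ * (2 * z.re) ^ 2 * (1 / (x * z.re) ^ 2)
        + x * (2 * z.re) ^ 3 * (4 / (x * z.re) ^ 3) := by gcongr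
    _ = 44 / x ^ 2 := by
      norm_num
      field_simp
      norm_num

theorem integrableOn_macTerm {z : ℂ} (hz : 0 < z.re) :
    MeasureTheory.IntegrableOn (macTerm z) (Set.Ioi 0) := by
  have hc : ContinuousOn (macTerm z) (Set.Ioi 0) := fun x hx =>
    (hasDerivAt_macTerm hz hx).continuousAt.continuousWithinAt
  refine MeasureTheory.Integrable.mono'
    ((integrableOn_exp_mul_Ioi (show -(z.re / 2) < 0 by linarith) 0).div_const z.re)
    (hc.aestronglyMeasurable measurableSet_Ioi) ?_
  filter_upwards [MeasureTheory.ae_restrict_mem measurableSet_Ioi] with x hx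
  exact norm_macTerm_le hz hx

/-! ### Euler–Maclaurin summation of the logarithm -/

theorem hasSum_zetaThree : HasSum (fun k : ℕ => 1 / ((k : ℝ) + 1) ^ 3) zetaThree := by
  have hs : Summable fun k : ℕ => 1 / ((k : ℝ) + 1) ^ 3 := by
    have := (summable_nat_add_iff (f := fun k : ℕ => 1 / (k : ℝ) ^ 3) 1).mpr
      (Real.summable_one_div_nat_pow.mpr (by norm_num))
    simpa using this
  have h : riemannZeta 3 = ((∑' k : ℕ, 1 / ((k : ℝ) + 1) ^ 3 : ℝ) : ℂ) := by
    rw [zeta_eq_tsum_one_div_nat_add_one_cpow (by norm_num), Complex.ofReal_tsum]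
    refine tsum_congr fun k => ?_
    push_cast
    congr 1
    exact_mod_cast Complex.cpow_natCast ((k : ℂ) + 1) 3
  have h2 : zetaThree = ∑' k : ℕ, 1 / ((k : ℝ) + 1) ^ 3 := by
    rw [zetaThree, h, Complex.ofReal_re]
  rw [h2]
  exact hs.hasSum

theorem zetaThree_pos : 0 < zetaThree := by
  rw [← hasSum_zetaThree.tsum_eq]
  exact hasSum_zetaThree.summable.tsum_pos (fun k => by positivity) 0 (by norm_num)

theorem norm_mul_exp_neg_mul_le {w : ℂ} (hw : 0 < w.re) {x : ℝ} (hx : 0 ≤ x) :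
    ‖(x : ℂ) * Complex.exp (-(x * w))‖ ≤ 2 / w.re * Real.exp (-(w.re / 2) * x) := by
  rw [norm_mul, Complex.norm_real, Real.norm_of_nonneg hx, Complex.norm_exp, Complex.neg_re,
    Complex.re_ofReal_mul]
  have h1 : x * w.re / 2 ≤ Real.exp (x * w.re / 2) := by
    linarith [Real.add_one_le_exp (x * w.re / 2)]
  have h2 : Real.exp (-(w.re / 2) * x) = Real.exp (x * w.re / 2) * Real.exp (-(x * w.re)) := by
    rw [← Real.exp_add]
    ring_nf
  rw [h2, ← mul_assoc]
  gcongr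
  rw [div_mul_eq_mul_div, le_div_iff₀ hw]
  linarith

theorem integrableOn_mul_exp_neg_mul {w : ℂ} (hw : 0 < w.re) :
    MeasureTheory.IntegrableOn (fun x : ℝ => (x : ℂ) * Complex.exp (-(x * w))) (Set.Ioi 0) := by
  refine MeasureTheory.Integrable.mono'
    ((integrableOn_exp_mul_Ioi (show -(w.re / 2) < 0 by linarith) 0).const_mul (2 / w.re))
    (Continuous.aestronglyMeasurable (by fun_prop)) ?_
  filter_upwards [MeasureTheory.ae_restrict_mem measurableSet_Ioi] with x hx
  exact norm_mul_exp_neg_mul_le hw (le_of_lt hx)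

theorem tendsto_exp_neg_half_mul {t : ℝ} (ht : 0 < t) :
    Tendsto (fun x : ℝ => Real.exp (-(t / 2) * x)) atTop (𝓝 0) :=
  Real.tendsto_exp_atBot.comp (tendsto_id.const_mul_atTop_of_neg (by linarith))

theorem integral_mul_exp_neg_mul {w : ℂ} (hw : 0 < w.re) :
    ∫ x in Set.Ioi (0 : ℝ), (x : ℂ) * Complex.exp (-(x * w)) = 1 / w ^ 2 := by
  have hw0 : w ≠ 0 := fun h0 => by simp [h0] at hw
  have hd : ∀ x ∈ Set.Ici (0 : ℝ), HasDerivAt (fun x : ℝ => -(x * Complex.exp (-(x * w))) / w -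
      Complex.exp (-(x * w)) / w ^ 2) ((x : ℂ) * Complex.exp (-(x * w))) x := fun x _ => by
    have he := hasDerivAt_exp_neg_mul w x
    refine (((((hasDerivAt_id x).ofReal_comp.mul he).neg).div_const w).sub
      (he.div_const (w ^ 2))).congr_deriv ?_
    simp only [id, Complex.ofReal_one]
    field_simp
    ring
  have h1 : Tendsto (fun x : ℝ => (x : ℂ) * Complex.exp (-(x * w))) atTop (𝓝 0) := by
    refine squeeze_zero_norm' (a := fun x : ℝ => 2 / w.re * Real.exp (-(w.re / 2) * x)) ?_ ?_
    · filter_upwards [eventually_ge_atTop 0] with x hx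
      exact norm_mul_exp_neg_mul_le hw hx
    · simpa using (tendsto_exp_neg_half_mul hw).const_mul (2 / w.re)
  have h2 : Tendsto (fun x : ℝ => Complex.exp (-(x * w))) atTop (𝓝 0) := by
    refine squeeze_zero_norm' (a := fun x : ℝ => Real.exp (-(w.re / 2) * x)) ?_
      (tendsto_exp_neg_half_mul hw)
    filter_upwards [eventually_ge_atTop 0] with x hx
    rw [Complex.norm_exp, Complex.neg_re, Complex.re_ofReal_mul, Real.exp_le_exp]
    nlinarith
  have h := MeasureTheory.integral_Ioi_of_hasDerivAt_of_tendsto' hd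
    (integrableOn_mul_exp_neg_mul hw) ((h1.neg.div_const w).sub (h2.div_const (w ^ 2)))
  rw [h]
  simp

/-- The integral is computed term by term, from `-log (1 - w) = ∑ w^k / k`. -/
theorem integral_macTerm {z : ℂ} (hz : 0 < z.re) :
    ∫ x in Set.Ioi (0 : ℝ), macTerm z x = zetaThree / z ^ 2 := by
  set F : ℕ → ℝ → ℂ := fun k x => 1 / ((k : ℂ) + 1) * (x * Complex.exp (-(x * (((k : ℂ) + 1) * z))))
    with hF
  have hw := fun k : ℕ => natCast_add_one_mul_re_pos hz k
  have hz0 : z ≠ 0 := fun h0 => by simp [h0] at hz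
  have hint : ∀ k, MeasureTheory.Integrable (F k)
      (MeasureTheory.volume.restrict (Set.Ioi 0)) := fun k =>
    (integrableOn_mul_exp_neg_mul (hw k)).const_mul _
  have hval : ∀ k : ℕ, ∫ x in Set.Ioi (0 : ℝ), F k x =
      ((1 / ((k : ℝ) + 1) ^ 3 : ℝ) : ℂ) * (1 / z ^ 2) := fun k => by
    have hk : (k : ℂ) + 1 ≠ 0 := Nat.cast_add_one_ne_zero k
    simp only [hF]
    rw [MeasureTheory.integral_const_mul, integral_mul_exp_neg_mul (hw k)]
    push_cast
    field_simp
  have hnorm : ∀ k : ℕ, ∫ x in Set.Ioi (0 : ℝ), ‖F k x‖ =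
      1 / ((k : ℝ) + 1) ^ 3 * (1 / z.re ^ 2) := fun k => by
    have hre : (0 : ℝ) < ((k : ℝ) + 1) * z.re := by positivity
    have h1 := integral_mul_exp_neg_mul (w := (((k : ℝ) + 1) * z.re : ℝ)) (by
      rw [Complex.ofReal_re]; exact hre)
    have h2 : ∫ x in Set.Ioi (0 : ℝ), x * Real.exp (-(x * (((k : ℝ) + 1) * z.re))) =
        1 / (((k : ℝ) + 1) * z.re) ^ 2 := by
      rw [← Complex.ofReal_inj, ← integral_complex_ofReal]
      push_cast at h1 ⊢
      exact h1
    have h3 : ∀ x ∈ Set.Ioi (0 : ℝ), ‖F k x‖ =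
        1 / ((k : ℝ) + 1) * (x * Real.exp (-(x * (((k : ℝ) + 1) * z.re)))) := fun x hx => by
      have e1 : ‖(k : ℂ) + 1‖ = (k : ℝ) + 1 := by
        have := Complex.norm_natCast (k + 1)
        push_cast at this
        exact this
      have e2 : (-((x : ℂ) * (((k : ℂ) + 1) * z))).re = -(x * (((k : ℝ) + 1) * z.re)) := by
        simp
      simp only [hF]
      rw [norm_mul, norm_mul, norm_div, e1, Complex.norm_exp, e2, Complex.norm_real, norm_one,
        Real.norm_of_nonneg (le_of_lt hx)]
    rw [MeasureTheory.setIntegral_congr_fun measurableSet_Ioi h3,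
      MeasureTheory.integral_const_mul, h2]
    field_simp
  have h := MeasureTheory.hasSum_integral_of_summable_integral_norm hint (by
    simp only [hnorm]
    exact hasSum_zetaThree.summable.mul_right _)
  simp only [hval] at h
  have h2 : HasSum (fun k : ℕ => ((1 / ((k : ℝ) + 1) ^ 3 : ℝ) : ℂ) * (1 / z ^ 2))
      ((zetaThree : ℂ) * (1 / z ^ 2)) := (Complex.hasSum_ofReal.mpr hasSum_zetaThree).mul_right _
  rw [← mul_one_div, ← h.unique h2]
  refine MeasureTheory.setIntegral_congr_fun measurableSet_Ioi fun x hx => ?_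
  have h3 := Complex.hasSum_taylorSeries_neg_log (norm_exp_neg_lt_one (ofReal_mul_re_pos hz hx))
  rw [← hasSum_nat_add_iff' 1] at h3
  simp only [macTerm]
  rw [← mul_neg, ← (by simpa using h3.mul_left (x : ℂ) : HasSum _ ((x : ℂ) *
    -Complex.log (1 - Complex.exp (-(x * z))))).tsum_eq]
  refine tsum_congr fun k => ?_
  simp only [hF]
  rw [← Complex.exp_nat_mul]
  push_cast
  ring_nf

theorem norm_integral_emKernel_mul_macTerm₃_le {z : ℂ} (hz : 0 < z.re) (hz2 : ‖z‖ ≤ 2 * z.re)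
    (k : ℕ) : ‖∫ s in (0 : ℝ)..1, (emKernel s : ℂ) * macTerm₃ z (((k : ℝ) + 1) + s)‖ ≤
      44 * (1 / ((k : ℝ) + 1) ^ 2) := by
  have h := intervalIntegral.norm_integral_le_of_norm_le_const (a := (0 : ℝ)) (b := 1)
    (f := fun s => (emKernel s : ℂ) * macTerm₃ z (((k : ℝ) + 1) + s))
    (C := 44 * (1 / ((k : ℝ) + 1) ^ 2)) fun s hs => by
      rw [Set.uIoc_of_le zero_le_one] at hs
      have h1 := abs_emKernel_le_one hs.1.le hs.2
      have hk : (0 : ℝ) < (k : ℝ) + 1 := by positivity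
      have h2 := norm_macTerm₃_le hz hz2 (x := ((k : ℝ) + 1) + s) (by linarith [hs.1])
      rw [norm_mul, Complex.norm_real, Real.norm_eq_abs]
      calc _ ≤ 1 * (44 / (((k : ℝ) + 1) + s) ^ 2) := by gcongr
        _ ≤ 1 * (44 / ((k : ℝ) + 1) ^ 2) := by
          gcongr 1 * (44 / ?_ ^ 2)
          linarith [hs.1]
        _ = _ := by ring
  simpa using h

theorem summable_one_div_add_one_sq : Summable fun k : ℕ => 1 / ((k : ℝ) + 1) ^ 2 := by
  have := (summable_nat_add_iff (f := fun k : ℕ => 1 / (k : ℝ) ^ 2) 1).mpr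
    (Real.summable_one_div_nat_pow.mpr (by norm_num))
  simpa using this

/-- The Euler–Maclaurin formula for `logMacMahon z`, in the sector `|z| ≤ 2 Re z`. -/
theorem logMacMahon_eq {z : ℂ} (hz : 0 < z.re) (hz2 : ‖z‖ ≤ 2 * z.re) :
    logMacMahon z = (∑' k : ℕ, ∫ s in (0 : ℝ)..1, (emKernel s : ℂ) * macTerm₃ z (((k : ℝ) + 1) + s))
      + macTerm z 1 / 2 - macTerm₁ z 1 / 12
      + (zetaThree / z ^ 2 - ∫ x in (0 : ℝ)..1, macTerm z x) := by
  have hN : Tendsto (fun N : ℕ => (N : ℝ) + 1) atTop atTop :=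
    tendsto_natCast_atTop_atTop.atTop_add tendsto_const_nhds
  have hT : Summable fun k : ℕ =>
      ∫ s in (0 : ℝ)..1, (emKernel s : ℂ) * macTerm₃ z (((k : ℝ) + 1) + s) :=
    Summable.of_norm_bounded (summable_one_div_add_one_sq.mul_left 44)
      (norm_integral_emKernel_mul_macTerm₃_le hz hz2)
  have h0 : Tendsto (fun N : ℕ => macTerm z ((N : ℝ) + 1)) atTop (𝓝 0) := by
    refine squeeze_zero_norm (fun N => norm_macTerm_le hz (by positivity)) ?_
    simpa using ((tendsto_exp_neg_half_mul hz).comp hN).div_const z.re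
  have h1 : Tendsto (fun N : ℕ => macTerm₁ z ((N : ℝ) + 1)) atTop (𝓝 0) := by
    refine squeeze_zero_norm (fun N => norm_macTerm₁_le hz (by simp)) ?_
    simpa using (((tendsto_exp_neg_half_mul hz).comp hN).const_mul (1 + ‖z‖)).div_const z.re
  have hi := MeasureTheory.intervalIntegral_tendsto_integral_Ioi 1
    ((integrableOn_macTerm hz).mono_set (Set.Ioi_subset_Ioi zero_le_one)) hN
  have hs : Tendsto (fun N => ∑ k ∈ Finset.range N, macTerm z ((k : ℝ) + 1)) atTop
      (𝓝 (logMacMahon z)) := by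
    refine (summable_logMacMahon hz).hasSum.tendsto_sum_nat.congr fun N => ?_
    simp [macTerm]
  have h := hT.hasSum.tendsto_sum_nat
  simp only [sum_integral_emKernel_mul (fun x hx => hasDerivAt_macTerm hz hx)
    (fun x hx => hasDerivAt_macTerm₁ hz hx) (fun x hx => hasDerivAt_macTerm₂ hz hx)
    (continuousOn_macTerm₃ hz)] at h
  have h2 := tendsto_nhds_unique h (((hs.add ((h0.sub_const (macTerm z 1)).div_const 2)).sub
    ((h1.sub_const (macTerm₁ z 1)).div_const 12)).sub hi)
  have h3 := MeasureTheory.setIntegral_union (Set.Ioc_disjoint_Ioi_same (a := (0 : ℝ)) (b := 1))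
    measurableSet_Ioi ((integrableOn_macTerm hz).mono_set Set.Ioc_subset_Ioi_self)
    ((integrableOn_macTerm hz).mono_set (Set.Ioi_subset_Ioi zero_le_one))
  rw [Set.Ioc_union_Ioi_eq_Ioi zero_le_one, integral_macTerm hz,
    ← intervalIntegral.integral_of_le zero_le_one] at h3
  rw [h2, h3]
  ring

/-! ### Asymptotics of the logarithm in a sector -/

/-- The sector `|z| ≤ 2 Re z` of the right half-plane, without its vertex. -/
def sector : Set ℂ := {z | 0 < z.re ∧ ‖z‖ ≤ 2 * z.re}

theorem sector_subset_ne_zero : sector ⊆ {0}ᶜ := fun z hz h0 => by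
  rw [Set.mem_singleton_iff] at h0
  have := hz.1
  simp [h0] at this

theorem tendsto_one_sub_exp_neg_div :
    Tendsto (fun w : ℂ => (1 - Complex.exp (-w)) / w) (𝓝[≠] 0) (𝓝 1) := by
  have h : HasDerivAt (fun w : ℂ => 1 - Complex.exp (-w)) 1 0 := by
    refine ((hasDerivAt_neg (0 : ℂ)).cexp.const_sub 1).congr_deriv ?_
    simp
  refine (hasDerivAt_iff_tendsto_slope_zero.mp h).congr fun w => ?_
  simp [div_eq_inv_mul]

theorem tendsto_ofReal_mul_sector {x : ℝ} (hx : 0 < x) :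
    Tendsto (fun z : ℂ => (x : ℂ) * z) (𝓝[sector] 0) (𝓝[≠] 0) := by
  refine tendsto_nhdsWithin_iff.mpr ⟨?_, ?_⟩
  · have : Tendsto (fun z : ℂ => (x : ℂ) * z) (𝓝 0) (𝓝 (x * 0)) := tendsto_id.const_mul _
    rw [mul_zero] at this
    exact this.mono_left nhdsWithin_le_nhds
  · filter_upwards [self_mem_nhdsWithin] with z hz
    exact mul_ne_zero (by exact_mod_cast hx.ne') (sector_subset_ne_zero hz)

theorem tendsto_macTerm₃ {x : ℝ} (hx : 0 < x) :
    Tendsto (fun z => macTerm₃ z x) (𝓝[sector] 0) (𝓝 ((1 / x ^ 2 : ℝ) : ℂ)) := by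
  have hρ := tendsto_one_sub_exp_neg_div
  have he : Tendsto (fun w : ℂ => Complex.exp (-w)) (𝓝[≠] 0) (𝓝 1) := by
    have : Tendsto (fun w : ℂ => Complex.exp (-w)) (𝓝 0) (𝓝 (Complex.exp (-0))) :=
      (by fun_prop : Continuous fun w : ℂ => Complex.exp (-w)).tendsto 0
    rw [neg_zero, Complex.exp_zero] at this
    exact this.mono_left nhdsWithin_le_nhds
  have h1 : Tendsto (fun w : ℂ => 3 * (Complex.exp (-w) / ((1 - Complex.exp (-w)) / w) ^ 2)
      - Complex.exp (-w) * (1 + Complex.exp (-w)) / ((1 - Complex.exp (-w)) / w) ^ 3) (𝓝[≠] 0)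
      (𝓝 (3 * (1 / 1 ^ 2) - 1 * (1 + 1) / 1 ^ 3)) :=
    ((he.div (hρ.pow 2) (by norm_num)).const_mul 3).sub
      ((he.mul (he.const_add 1)).div (hρ.pow 3) (by norm_num))
  have h2 := ((h1.comp (tendsto_ofReal_mul_sector hx)).mul_const (1 / (x : ℂ) ^ 2))
  have e : (3 * (1 / 1 ^ 2) - 1 * (1 + 1) / 1 ^ 3 : ℂ) * (1 / (x : ℂ) ^ 2) =
      ((1 / x ^ 2 : ℝ) : ℂ) := by
    push_cast
    ring
  rw [e] at h2
  refine h2.congr' ?_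
  filter_upwards [self_mem_nhdsWithin] with z hz
  have hz0 : z ≠ 0 := sector_subset_ne_zero hz
  have hx0 : (x : ℂ) ≠ 0 := by exact_mod_cast hx.ne'
  have h0 := one_sub_exp_neg_ne_zero (ofReal_mul_re_pos hz.1 hx)
  simp only [Function.comp_apply, macTerm₃]
  generalize Complex.exp (-(x * z)) = e at h0 ⊢
  field_simp

/-- The Euler–Maclaurin remainders of `macTerm z` tend, in total, to the opposite of those of
`x log x`. -/
theorem tendsto_tsum_integral_emKernel_macTerm₃ :
    Tendsto (fun z => ∑' k : ℕ, ∫ s in (0 : ℝ)..1,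
      (emKernel s : ℂ) * macTerm₃ z (((k : ℝ) + 1) + s)) (𝓝[sector] 0)
      (𝓝 ((1 / 4 - Real.log glaisherKinkelin : ℝ) : ℂ)) := by
  have hlim : ∀ k : ℕ, Tendsto (fun z => ∫ s in (0 : ℝ)..1,
      (emKernel s : ℂ) * macTerm₃ z (((k : ℝ) + 1) + s)) (𝓝[sector] 0)
      (𝓝 (∫ s in (0 : ℝ)..1, (emKernel s : ℂ) * ((1 / (((k : ℝ) + 1) + s) ^ 2 : ℝ) : ℂ))) := by
    intro k
    have hpos : ∀ s ∈ Set.uIoc (0 : ℝ) 1, (0 : ℝ) < ((k : ℝ) + 1) + s := fun s hs => by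
      rw [Set.uIoc_of_le zero_le_one] at hs
      have := hs.1
      positivity
    refine intervalIntegral.tendsto_integral_filter_of_dominated_convergence (fun _ => 44) ?_ ?_
      intervalIntegrable_const ?_
    · filter_upwards [self_mem_nhdsWithin] with z hz
      refine ContinuousOn.aestronglyMeasurable ?_ measurableSet_uIoc
      refine (Complex.continuous_ofReal.comp continuous_emKernel).continuousOn.mul ?_
      exact (continuousOn_macTerm₃ hz.1).comp (by fun_prop) hpos
    · filter_upwards [self_mem_nhdsWithin] with z hz
      refine Eventually.of_forall fun s hs => ?_
      have h2 := norm_macTerm₃_le hz.1 hz.2 (hpos s hs)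
      rw [Set.uIoc_of_le zero_le_one] at hs
      have h1 := abs_emKernel_le_one hs.1.le hs.2
      have h3 : 44 / (((k : ℝ) + 1) + s) ^ 2 ≤ 44 := by
        refine div_le_self (by norm_num) ?_
        have : (0 : ℝ) ≤ k := by positivity
        nlinarith [hs.1]
      rw [norm_mul, Complex.norm_real, Real.norm_eq_abs]
      calc _ ≤ 1 * (44 : ℝ) := by
            gcongr
            exact h2.trans h3
        _ = 44 := one_mul _
    · exact Eventually.of_forall fun s hs => (tendsto_macTerm₃ (hpos s hs)).const_mul _
  have hb : ∀ᶠ z in 𝓝[sector] (0 : ℂ), ∀ k : ℕ, ‖∫ s in (0 : ℝ)..1,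
      (emKernel s : ℂ) * macTerm₃ z (((k : ℝ) + 1) + s)‖ ≤ 44 * (1 / ((k : ℝ) + 1) ^ 2) := by
    filter_upwards [self_mem_nhdsWithin] with z hz
    exact norm_integral_emKernel_mul_macTerm₃_le hz.1 hz.2
  have hs44 := summable_one_div_add_one_sq.mul_left 44
  have h := tendsto_tsum_of_dominated_convergence hs44 hlim hb
  have hne : (𝓝[sector] (0 : ℂ)).NeBot := by
    have : Tendsto (fun n : ℕ => ((1 / ((n : ℝ) + 1) : ℝ) : ℂ)) atTop (𝓝[sector] 0) := by
      refine tendsto_nhdsWithin_iff.mpr ⟨?_, Eventually.of_forall fun n => ?_⟩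
      · exact_mod_cast (Complex.continuous_ofReal.tendsto _).comp
          (tendsto_one_div_add_atTop_nhds_zero_nat (𝕜 := ℝ))
      · have h1 : 0 < 1 / ((n : ℝ) + 1) := by positivity
        refine ⟨by rw [Complex.ofReal_re]; exact h1, ?_⟩
        rw [Complex.norm_real, Complex.ofReal_re, Real.norm_of_nonneg h1.le]
        linarith
    exact this.neBot
  have hsum : Summable fun k : ℕ => ∫ s in (0 : ℝ)..1,
      (emKernel s : ℂ) * ((1 / (((k : ℝ) + 1) + s) ^ 2 : ℝ) : ℂ) := by
    refine Summable.of_norm_bounded hs44 fun k => ?_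
    exact le_of_tendsto (hlim k).norm (hb.mono fun z hz => hz k)
  have h2 := tendsto_nhds_unique hsum.hasSum.tendsto_sum_nat
    (tendsto_sum_integral_emKernel_neg_inv_sq.neg.congr fun N => by
      rw [← Finset.sum_neg_distrib]
      refine Finset.sum_congr rfl fun k _ => ?_
      rw [← intervalIntegral.integral_neg]
      simp)
  rw [h2] at h
  simpa using h

/-- `log ((1 - e^(-w)) / w)` vanishes at `0`. -/
theorem tendsto_log_one_sub_exp_neg_div :
    Tendsto (fun w : ℂ => Complex.log ((1 - Complex.exp (-w)) / w)) (𝓝[≠] 0) (𝓝 0) := by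
  have := tendsto_one_sub_exp_neg_div.clog Complex.one_mem_slitPlane
  rwa [Complex.log_one] at this

/-- Near `0` in the right half-plane the arguments of `w` and `(1 - e^(-w)) / w` are less than
`π / 2` in absolute value, so that the principal logarithm is additive. -/
theorem eventually_log_one_sub_exp_neg_eq : ∀ᶠ w in 𝓝[≠] (0 : ℂ), 0 < w.re →
    Complex.log (1 - Complex.exp (-w)) =
      Complex.log w + Complex.log ((1 - Complex.exp (-w)) / w) := by
  have h : ∀ᶠ w in 𝓝[≠] (0 : ℂ), 0 < ((1 - Complex.exp (-w)) / w).re :=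
    ((Complex.continuous_re.tendsto _).comp tendsto_one_sub_exp_neg_div).eventually
      (lt_mem_nhds (by simp))
  filter_upwards [h, self_mem_nhdsWithin] with w hw hw0 hre
  have hw0 : w ≠ 0 := hw0
  have h1 := abs_lt.mp (Complex.abs_arg_lt_pi_div_two_iff.mpr (Or.inl hw))
  have h2 := abs_lt.mp (Complex.abs_arg_lt_pi_div_two_iff.mpr (Or.inl hre))
  rw [← Complex.log_mul hw0 (fun h0 => by simp [h0] at hw) ⟨by linarith, by linarith⟩,
    mul_div_cancel₀ _ hw0]

theorem tendsto_macTerm_one :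
    Tendsto (fun z => macTerm z 1 + Complex.log z) (𝓝[sector] 0) (𝓝 0) := by
  have hle : 𝓝[sector] (0 : ℂ) ≤ 𝓝[≠] 0 := nhdsWithin_mono _ sector_subset_ne_zero
  have h := (tendsto_log_one_sub_exp_neg_div.mono_left hle).neg
  rw [neg_zero] at h
  refine h.congr' ?_
  filter_upwards [hle eventually_log_one_sub_exp_neg_eq, self_mem_nhdsWithin] with z hz hz'
  simp only [macTerm, Complex.ofReal_one, one_mul, hz hz'.1]
  ring

theorem tendsto_macTerm₁_one :
    Tendsto (fun z => macTerm₁ z 1 + Complex.log z) (𝓝[sector] 0) (𝓝 (-1)) := by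
  have hle : 𝓝[sector] (0 : ℂ) ≤ 𝓝[≠] 0 := nhdsWithin_mono _ sector_subset_ne_zero
  have he : Tendsto (fun w : ℂ => Complex.exp (-w)) (𝓝[sector] 0) (𝓝 1) := by
    have : Tendsto (fun w : ℂ => Complex.exp (-w)) (𝓝 0) (𝓝 (Complex.exp (-0))) :=
      (by fun_prop : Continuous fun w : ℂ => Complex.exp (-w)).tendsto 0
    rw [neg_zero, Complex.exp_zero] at this
    exact this.mono_left nhdsWithin_le_nhds
  have h := tendsto_macTerm_one.sub
    (he.div (tendsto_one_sub_exp_neg_div.mono_left hle) one_ne_zero)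
  have e : (0 : ℂ) - 1 / 1 = -1 := by norm_num
  rw [e] at h
  refine h.congr' ?_
  filter_upwards [self_mem_nhdsWithin] with z hz
  have h0 := one_sub_exp_neg_ne_zero hz.1
  have hz0 : z ≠ 0 := sector_subset_ne_zero hz
  simp only [macTerm, macTerm₁, Complex.ofReal_one, one_mul, Pi.div_apply]
  field_simp
  ring

theorem integral_mul_log_zero_one : ∫ x in (0 : ℝ)..1, x * Real.log x = -(1 / 4) := by
  have hc : ContinuousOn (fun x : ℝ => x * (x * Real.log x) / 2 - x ^ 2 / 4) (Set.Icc 0 1) :=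
    (((continuous_id.mul Real.continuous_mul_log).div_const 2).sub
      (by fun_prop : Continuous fun x : ℝ => x ^ 2 / 4)).continuousOn
  rw [intervalIntegral.integral_eq_sub_of_hasDerivAt_of_le zero_le_one hc]
  · simp
  · intro x hx
    have hx0 : x ≠ 0 := hx.1.ne'
    refine ((((hasDerivAt_id x).mul (Real.hasDerivAt_mul_log hx0)).div_const 2).sub
      ((hasDerivAt_pow 2 x).div_const 4)).congr_deriv ?_
    simp only [id]
    push_cast
    ring
  · exact Real.continuous_mul_log.intervalIntegrable _ _

theorem tendsto_integral_macTerm_zero_one :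
    Tendsto (fun z => (∫ x in (0 : ℝ)..1, macTerm z x) + Complex.log z / 2) (𝓝[sector] 0)
      (𝓝 (1 / 4)) := by
  have hle : 𝓝[sector] (0 : ℂ) ≤ 𝓝[≠] 0 := nhdsWithin_mono _ sector_subset_ne_zero
  -- uniformity in `x` of the expansion of `log (1 - e^(-xz))`, from a ball around `0`
  have hball : ∀ᶠ z in 𝓝[sector] (0 : ℂ), ∀ x ∈ Set.Ioc (0 : ℝ) 1,
      ‖Complex.log ((1 - Complex.exp (-(x * z))) / (x * z))‖ ≤ 1 ∧
      Complex.log (1 - Complex.exp (-(x * z))) =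
        Complex.log (x * z) + Complex.log ((1 - Complex.exp (-(x * z))) / (x * z)) := by
    have h1 : ∀ᶠ w in 𝓝[≠] (0 : ℂ), ‖Complex.log ((1 - Complex.exp (-w)) / w)‖ ≤ 1 :=
      (tendsto_log_one_sub_exp_neg_div.norm.eventually (gt_mem_nhds (by simp))).mono
        fun w hw => le_of_lt hw
    obtain ⟨δ, hδ, hδ'⟩ := Metric.mem_nhdsWithin_iff.mp (h1.and eventually_log_one_sub_exp_neg_eq)
    filter_upwards [self_mem_nhdsWithin, nhdsWithin_le_nhds (Metric.ball_mem_nhds (0 : ℂ) hδ)]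
      with z hz hzδ x hx
    have hre := ofReal_mul_re_pos hz.1 hx.1
    have hmem : (x : ℂ) * z ∈ Metric.ball (0 : ℂ) δ ∩ {0}ᶜ := by
      refine ⟨?_, fun h0 => ?_⟩
      · rw [mem_ball_zero_iff] at hzδ ⊢
        rw [norm_mul, Complex.norm_real, Real.norm_of_nonneg hx.1.le]
        exact (mul_le_of_le_one_left (norm_nonneg _) hx.2).trans_lt hzδ
      · rw [Set.mem_singleton_iff] at h0
        rw [h0] at hre
        simp at hre
    have := hδ' hmem
    exact ⟨this.1, this.2 hre⟩
  have hlim : Tendsto (fun z => ∫ x in (0 : ℝ)..1,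
      -((x : ℂ) * Complex.log ((1 - Complex.exp (-(x * z))) / (x * z)))) (𝓝[sector] 0) (𝓝 0) := by
    suffices h : Tendsto (fun z => ∫ x in (0 : ℝ)..1,
        -((x : ℂ) * Complex.log ((1 - Complex.exp (-(x * z))) / (x * z)))) (𝓝[sector] 0)
        (𝓝 (∫ x in (0 : ℝ)..1, -((x : ℂ) * 0))) by
      simpa only [mul_zero, neg_zero, intervalIntegral.integral_zero] using h
    refine intervalIntegral.tendsto_integral_filter_of_dominated_convergence (fun _ => 1) ?_ ?_
      intervalIntegrable_const ?_
    · refine Eventually.of_forall fun z => Measurable.aestronglyMeasurable ?_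
      have : Measurable fun x : ℝ => (1 - Complex.exp (-(x * z))) / (x * z) := by fun_prop
      exact (Complex.measurable_ofReal.mul (Complex.measurable_log.comp this)).neg
    · filter_upwards [hball] with z hz
      refine Eventually.of_forall fun x hx => ?_
      rw [Set.uIoc_of_le zero_le_one] at hx
      rw [norm_neg, norm_mul, Complex.norm_real, Real.norm_of_nonneg hx.1.le]
      exact mul_le_one₀ hx.2 (norm_nonneg _) (hz x hx).1
    · refine Eventually.of_forall fun x hx => ?_
      rw [Set.uIoc_of_le zero_le_one] at hx
      exact ((tendsto_log_one_sub_exp_neg_div.comp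
        (tendsto_ofReal_mul_sector hx.1)).const_mul (x : ℂ)).neg
  have h := hlim.add_const (1 / 4 : ℂ)
  rw [zero_add] at h
  refine h.congr' ?_
  filter_upwards [hball, self_mem_nhdsWithin] with z hz hzs
  have hz0 : z ≠ 0 := sector_subset_ne_zero hzs
  have i1 : IntervalIntegrable (macTerm z) MeasureTheory.volume 0 1 := by
    rw [intervalIntegrable_iff_integrableOn_Ioc_of_le zero_le_one]
    exact (integrableOn_macTerm hzs.1).mono_set Set.Ioc_subset_Ioi_self
  have i2 : IntervalIntegrable (fun x : ℝ => ((x * Real.log x : ℝ) : ℂ))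
      MeasureTheory.volume 0 1 :=
    (Complex.continuous_ofReal.comp Real.continuous_mul_log).intervalIntegrable _ _
  have i3 : IntervalIntegrable (fun x : ℝ => (x : ℂ) * Complex.log z) MeasureTheory.volume 0 1 :=
    (by fun_prop : Continuous fun x : ℝ => (x : ℂ) * Complex.log z).intervalIntegrable _ _
  have e2 : ∫ x in (0 : ℝ)..1, (x : ℂ) * Complex.log z = Complex.log z / 2 := by
    rw [intervalIntegral.integral_mul_const, intervalIntegral.integral_ofReal, integral_id]
    push_cast
    ring
  have e3 : ∫ x in (0 : ℝ)..1, -((x : ℂ) * Complex.log ((1 - Complex.exp (-(x * z))) / (x * z))) =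
      ∫ x in (0 : ℝ)..1, (macTerm z x + ((x * Real.log x : ℝ) : ℂ) + x * Complex.log z) := by
    refine intervalIntegral.integral_congr_ae (Eventually.of_forall fun x hx => ?_)
    rw [Set.uIoc_of_le zero_le_one] at hx
    simp only [macTerm, (hz x hx).2, Complex.log_ofReal_mul hx.1 hz0]
    push_cast
    ring
  rw [e3, intervalIntegral.integral_add (i1.add i2) i3, intervalIntegral.integral_add i1 i2, e2,
    intervalIntegral.integral_ofReal, integral_mul_log_zero_one]
  push_cast
  ring

/-- The behaviour at `0` of the logarithm of MacMahon's product, in a sector. -/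
theorem tendsto_logMacMahon_sub :
    Tendsto (fun z => logMacMahon z - zetaThree / z ^ 2 - Complex.log z / 12) (𝓝[sector] 0)
      (𝓝 ((1 / 12 - Real.log glaisherKinkelin : ℝ) : ℂ)) := by
  have h := ((tendsto_tsum_integral_emKernel_macTerm₃.add (tendsto_macTerm_one.div_const 2)).sub
    (tendsto_macTerm₁_one.div_const 12)).sub tendsto_integral_macTerm_zero_one
  have e : (((1 / 4 - Real.log glaisherKinkelin : ℝ) : ℂ) + 0 / 2 - -1 / 12 - 1 / 4 : ℂ) =
      ((1 / 12 - Real.log glaisherKinkelin : ℝ) : ℂ) := by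
    push_cast
    ring
  rw [e] at h
  refine h.congr' ?_
  filter_upwards [self_mem_nhdsWithin] with z hz
  rw [logMacMahon_eq hz.1 hz.2]
  ring

/-! ### The saddle point method -/

theorem integral_exp_int_mul_I (j : ℤ) :
    ∫ y in (-Real.pi)..Real.pi, Complex.exp (j * Complex.I * y) =
      if j = 0 then 2 * (Real.pi : ℂ) else 0 := by
  split_ifs with h
  · simp only [h, Int.cast_zero, zero_mul, Complex.exp_zero, intervalIntegral.integral_const]
    rw [Complex.real_smul]
    push_cast
    ring
  · have hj : (j : ℂ) * Complex.I ≠ 0 := mul_ne_zero (by exact_mod_cast h) Complex.I_ne_zero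
    rw [integral_exp_mul_complex hj]
    have : Complex.exp (j * Complex.I * Real.pi) =
        Complex.exp (j * Complex.I * (-Real.pi : ℝ)) := by
      rw [Complex.exp_eq_exp_iff_exists_int]
      exact ⟨j, by push_cast; ring⟩
    rw [this, sub_self, zero_div]

theorem HasEval.hasSum {f : PowerSeries ℝ} {q v : ℂ} (h : HasEval f q v) :
    HasSum (fun n => ((PowerSeries.coeff n f : ℝ) : ℂ) * q ^ n) v := by
  rw [← h.2]
  exact h.1.of_norm.hasSum

theorem norm_coeff_mul_exp_pow (f : PowerSeries ℝ) (t y : ℝ) (k : ℕ) :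
    ‖((PowerSeries.coeff k f : ℝ) : ℂ) * Complex.exp (-(t + y * Complex.I)) ^ k‖ =
      ‖((PowerSeries.coeff k f : ℝ) : ℂ) * Complex.exp (-(t : ℂ)) ^ k‖ := by
  rw [norm_mul, norm_mul, norm_pow, norm_pow, Complex.norm_exp, Complex.norm_exp]
  simp

theorem continuous_exp_of_hasEval {f : PowerSeries ℝ} {M : ℂ → ℂ}
    (hF : ∀ z : ℂ, 0 < z.re → HasEval f (Complex.exp (-z)) (Complex.exp (M z)))
    {t : ℝ} (ht : 0 < t) : Continuous fun y : ℝ => Complex.exp (M (t + y * Complex.I)) := by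
  have h : (fun y : ℝ => Complex.exp (M (t + y * Complex.I))) = fun y : ℝ =>
      ∑' k, ((PowerSeries.coeff k f : ℝ) : ℂ) * Complex.exp (-(t + y * Complex.I)) ^ k := by
    funext y
    exact (hF _ (by simpa using ht)).2.symm
  rw [h]
  refine continuous_tsum (fun k => by fun_prop) (hF t (by simpa using ht)).1 fun k y => ?_
  exact (norm_coeff_mul_exp_pow f t y k).le

/-- Cauchy's coefficient formula on the circle of radius `e^(-t)`. -/
theorem integral_eq_coeff {f : PowerSeries ℝ} {M : ℂ → ℂ}
    (hF : ∀ z : ℂ, 0 < z.re → HasEval f (Complex.exp (-z)) (Complex.exp (M z)))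
    {t : ℝ} (ht : 0 < t) (n : ℕ) :
    ∫ y in (-Real.pi)..Real.pi,
      Complex.exp (M (t + y * Complex.I)) * Complex.exp (n * y * Complex.I) =
      2 * Real.pi * (PowerSeries.coeff n f * Real.exp (-(n * t)) : ℝ) := by
  have h := intervalIntegral.hasSum_integral_of_dominated_convergence
    (μ := MeasureTheory.volume) (a := -Real.pi) (b := Real.pi)
    (F := fun k (y : ℝ) => ((PowerSeries.coeff k f : ℝ) : ℂ) *
      Complex.exp (-(t + y * Complex.I)) ^ k * Complex.exp (n * y * Complex.I))
    (f := fun y => Complex.exp (M (t + y * Complex.I)) * Complex.exp (n * y * Complex.I))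
    (fun k _ => ‖((PowerSeries.coeff k f : ℝ) : ℂ) * Complex.exp (-(t : ℂ)) ^ k‖)
    (fun k => Continuous.aestronglyMeasurable (by fun_prop))
    (fun k => Eventually.of_forall fun y _ => by
      rw [norm_mul, norm_coeff_mul_exp_pow]
      have : ‖Complex.exp (n * y * Complex.I)‖ = 1 := by
        rw [← Complex.norm_exp_ofReal_mul_I (n * y)]
        push_cast
        rfl
      rw [this, mul_one])
    (Eventually.of_forall fun y _ => (hF t (by simpa using ht)).1)
    intervalIntegrable_const
    (Eventually.of_forall fun y _ => (hF _ (by simpa using ht)).hasSum.mul_right _)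
  have hterm : ∀ k : ℕ, ∫ y in (-Real.pi)..Real.pi, ((PowerSeries.coeff k f : ℝ) : ℂ) *
      Complex.exp (-(t + y * Complex.I)) ^ k * Complex.exp (n * y * Complex.I) =
      if k = n then 2 * (Real.pi : ℂ) * (PowerSeries.coeff n f * Real.exp (-(n * t)) : ℝ)
        else 0 := by
    intro k
    have e : ∀ y : ℝ, ((PowerSeries.coeff k f : ℝ) : ℂ) *
        Complex.exp (-(t + y * Complex.I)) ^ k * Complex.exp (n * y * Complex.I) =
        ((PowerSeries.coeff k f * Real.exp (-(k * t)) : ℝ) : ℂ) *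
          Complex.exp (((n - k : ℤ) : ℂ) * Complex.I * y) := fun y => by
      push_cast
      rw [← Complex.exp_nat_mul, mul_assoc ((PowerSeries.coeff k f : ℝ) : ℂ),
        mul_assoc ((PowerSeries.coeff k f : ℝ) : ℂ), ← Complex.exp_add, ← Complex.exp_add]
      ring_nf
    simp only [e]
    rw [intervalIntegral.integral_const_mul, integral_exp_int_mul_I]
    by_cases hk : k = n
    · subst hk
      simp
      ring
    · have : ((n : ℤ) - k) ≠ 0 := by omega
      simp [hk, this]
  simp only [hterm] at h
  exact h.unique (hasSum_ite_eq n _)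

/-- Coefficient asymptotics by the saddle point method. If `f(e^(-z)) = exp (M z)`, where
`M z = c / z² + β log z + κ + o(1)` as `z → 0` in a sector, and if `|f|` decays fast enough along
the circles `|q| = e^(-t)`, on the scale `t²` in the argument of `q`, then the coefficients of `f`
are governed by the saddle point `t = (2c / n)^(1/3)` of `c / t² + n t`. -/
theorem tendsto_coeff_div_saddle {f : PowerSeries ℝ} {M : ℂ → ℂ}
    (hF : ∀ z : ℂ, 0 < z.re → HasEval f (Complex.exp (-z)) (Complex.exp (M z)))
    {c β κ : ℝ} (hc : 0 < c)
    (hM : Tendsto (fun z => M z - c / z ^ 2 - β * Complex.log z) (𝓝[sector] 0) (𝓝 (κ : ℂ)))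
    {B : ℝ → ℝ} (hB : MeasureTheory.Integrable B) (hB0 : ∀ u, 0 ≤ B u)
    (hb : ∀ t : ℝ, 0 < t → t ≤ 1 → ∀ u : ℝ, |t ^ 2 * u| ≤ Real.pi →
      ‖Complex.exp (M (t + (t ^ 2 * u : ℝ) * Complex.I))‖ ≤ ‖Complex.exp (M t)‖ * B u)
    {τ : ℕ → ℝ} (hτ0 : ∀ᶠ n in atTop, 0 < τ n) (hτ : Tendsto τ atTop (𝓝 0))
    (hτn : ∀ᶠ n : ℕ in atTop, n * τ n ^ 3 = 2 * c) :
    Tendsto (fun n : ℕ => PowerSeries.coeff n f /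
      (Real.exp κ * τ n ^ β * Real.exp (c / τ n ^ 2 + n * τ n) * τ n ^ 2 / √(12 * Real.pi * c)))
      atTop (𝓝 1) := by
  set Q : ℕ → ℝ → ℂ := fun n => Set.indicator (Set.Ioc (-(Real.pi / τ n ^ 2)) (Real.pi / τ n ^ 2))
    fun u => Complex.exp (M (τ n + (τ n ^ 2 * u : ℝ) * Complex.I)) / Complex.exp (M (τ n)) *
      Complex.exp (n * (τ n ^ 2 * u : ℝ) * Complex.I) with hQ
  -- Cauchy's formula in the scaled variable `u`
  have hcauchy : ∀ᶠ n : ℕ in atTop, ((PowerSeries.coeff n f : ℝ) : ℂ) =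
      Complex.exp (M (τ n)) * Real.exp (n * τ n) * (τ n ^ 2 / (2 * Real.pi) : ℝ) * ∫ u, Q n u := by
    filter_upwards [hτ0] with n hn
    have hpi := Real.pi_pos
    have hle : -(Real.pi / τ n ^ 2) ≤ Real.pi / τ n ^ 2 := by
      have : 0 < Real.pi / τ n ^ 2 := by positivity
      linarith
    have h1 := integral_eq_coeff hF hn n
    have h2 := intervalIntegral.smul_integral_comp_mul_left (a := -(Real.pi / τ n ^ 2))
      (b := Real.pi / τ n ^ 2) (fun y : ℝ => Complex.exp (M (τ n + y * Complex.I)) *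
        Complex.exp (n * y * Complex.I)) (τ n ^ 2)
    rw [mul_neg, mul_div_cancel₀ _ (by positivity), h1] at h2
    have h3 : ∫ u, Q n u = (∫ u in (-(Real.pi / τ n ^ 2))..(Real.pi / τ n ^ 2),
        Complex.exp (M (τ n + (τ n ^ 2 * u : ℝ) * Complex.I)) *
          Complex.exp (n * (τ n ^ 2 * u : ℝ) * Complex.I)) / Complex.exp (M (τ n)) := by
      simp only [hQ]
      rw [MeasureTheory.integral_indicator measurableSet_Ioc,
        ← intervalIntegral.integral_of_le hle, ← intervalIntegral.integral_div]
      congr 1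
      funext u
      ring
    rw [h3]
    have h4 : ((PowerSeries.coeff n f : ℝ) : ℂ) = (Real.exp (n * τ n) / (2 * Real.pi) : ℝ) *
        (2 * Real.pi * (PowerSeries.coeff n f * Real.exp (-(n * τ n)) : ℝ)) := by
      have e : Real.exp (n * τ n) * Real.exp (-(n * τ n)) = 1 := by
        rw [← Real.exp_add, add_neg_cancel, Real.exp_zero]
      have : PowerSeries.coeff n f = Real.exp (n * τ n) / (2 * Real.pi) *
        (2 * Real.pi * (PowerSeries.coeff n f * Real.exp (-(n * τ n)))) := by
        field_simp
        linear_combination (-PowerSeries.coeff n f) * e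
      exact_mod_cast this
    rw [h4, ← h2, Complex.real_smul]
    have h0 := Complex.exp_ne_zero (M (τ n))
    generalize (∫ u in (-(Real.pi / τ n ^ 2))..(Real.pi / τ n ^ 2),
        Complex.exp (M (τ n + (τ n ^ 2 * u : ℝ) * Complex.I)) *
          Complex.exp (n * (τ n ^ 2 * u : ℝ) * Complex.I)) = J
    push_cast
    field_simp
  -- the points at scaled distance `u` from the saddle points are eventually in the sector
  have hz : ∀ u : ℝ, Tendsto (fun n => (τ n : ℂ) + (τ n ^ 2 * u : ℝ) * Complex.I) atTop
      (𝓝[sector] 0) := by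
    intro u
    refine tendsto_nhdsWithin_iff.mpr ⟨?_, ?_⟩
    · have : Tendsto (fun t : ℝ => (t : ℂ) + (t ^ 2 * u : ℝ) * Complex.I) (𝓝 0)
          (𝓝 (((0 : ℝ) : ℂ) + ((0 : ℝ) ^ 2 * u : ℝ) * Complex.I)) :=
        (by fun_prop : Continuous fun t : ℝ => (t : ℂ) + (t ^ 2 * u : ℝ) * Complex.I).tendsto 0
      simpa [Function.comp_def] using this.comp hτ
    · have h1 : Tendsto (fun n => τ n * |u|) atTop (𝓝 0) := by simpa using hτ.mul_const |u|
      filter_upwards [hτ0, h1.eventually (gt_mem_nhds one_pos)] with n hn hn1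
      have hre : ((τ n : ℂ) + (τ n ^ 2 * u : ℝ) * Complex.I).re = τ n := by
        simp [-Complex.ofReal_mul, -Complex.ofReal_pow]
      refine ⟨by rw [hre]; exact hn, ?_⟩
      rw [hre]
      refine (norm_add_le _ _).trans ?_
      rw [norm_mul, Complex.norm_I, mul_one, Complex.norm_real, Complex.norm_real,
        Real.norm_of_nonneg hn.le, Real.norm_eq_abs, abs_mul, abs_of_nonneg (sq_nonneg (τ n))]
      nlinarith
  have hR : Tendsto (fun n => M (τ n) - c / (τ n : ℂ) ^ 2 - β * Complex.log (τ n)) atTop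
      (𝓝 (κ : ℂ)) := by
    simpa [Function.comp_def] using hM.comp (hz 0)
  -- with `v = i t u` and `n = 2c / t³`, the main part of the exponent is
  -- `c / t² ((1 + v)⁻² - 1 + 2v) = -c u² (3 + 2v) / (1 + v)²`
  have hpt : ∀ u : ℝ, Tendsto (fun n => Q n u) atTop
      (𝓝 ((Real.exp (-(3 * c) * u ^ 2) : ℝ) : ℂ)) := by
    intro u
    have h1 := (hM.comp (hz u)).sub hR
    rw [sub_self] at h1
    have hv : Tendsto (fun n => 1 + (τ n * u : ℝ) * Complex.I) atTop (𝓝 1) := by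
      have h := ((Complex.continuous_ofReal.tendsto _).comp (hτ.mul_const u)).mul_const Complex.I
      simpa using h.const_add 1
    have h2 : Tendsto (fun n => Complex.log (1 + (τ n * u : ℝ) * Complex.I)) atTop (𝓝 0) := by
      have := hv.clog Complex.one_mem_slitPlane
      rwa [Complex.log_one] at this
    have h3 : Tendsto (fun n => -(c * (u : ℂ) ^ 2) * ((1 + 2 * (1 + (τ n * u : ℝ) * Complex.I)) /
        (1 + (τ n * u : ℝ) * Complex.I) ^ 2)) atTop
        (𝓝 (-(c * (u : ℂ) ^ 2) * ((1 + 2 * 1) / 1 ^ 2))) :=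
      (((hv.const_mul 2).const_add 1).div (hv.pow 2) (by norm_num)).const_mul _
    have h4 := ((h1.add (h2.const_mul (β : ℂ))).add h3).cexp
    have e4 : Complex.exp (0 + (β : ℂ) * 0 + -(c * (u : ℂ) ^ 2) * ((1 + 2 * 1) / 1 ^ 2)) =
        ((Real.exp (-(3 * c) * u ^ 2) : ℝ) : ℂ) := by
      push_cast
      ring_nf
    rw [e4] at h4
    refine h4.congr' ?_
    have h5 : Tendsto (fun n => τ n ^ 2 * |u|) atTop (𝓝 0) := by
      simpa using (hτ.pow 2).mul_const |u|
    filter_upwards [hτ0, hτn, h5.eventually (gt_mem_nhds Real.pi_pos),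
      hv.eventually_ne one_ne_zero] with n hn hn3 hnπ hv0
    have hmem : u ∈ Set.Ioc (-(Real.pi / τ n ^ 2)) (Real.pi / τ n ^ 2) := by
      have : |u| < Real.pi / τ n ^ 2 := by
        rw [lt_div_iff₀ (by positivity), mul_comm]
        exact hnπ
      exact ⟨(abs_lt.mp this).1, (abs_lt.mp this).2.le⟩
    have ht0 : (τ n : ℂ) ≠ 0 := by exact_mod_cast hn.ne'
    have ez : (τ n : ℂ) + (τ n ^ 2 * u : ℝ) * Complex.I =
        τ n * (1 + (τ n * u : ℝ) * Complex.I) := by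
      push_cast
      ring
    have el : Complex.log ((τ n : ℂ) + (τ n ^ 2 * u : ℝ) * Complex.I) =
        Complex.log (τ n) + Complex.log (1 + (τ n * u : ℝ) * Complex.I) := by
      rw [ez, Complex.log_ofReal_mul hn hv0, Complex.ofReal_log hn.le]
    have en : (n : ℂ) = 2 * c / (τ n : ℂ) ^ 3 := by
      rw [eq_div_iff (pow_ne_zero 3 ht0)]
      exact_mod_cast hn3
    simp only [hQ, Set.indicator_of_mem hmem, Function.comp_apply]
    rw [← Complex.exp_sub, ← Complex.exp_add, el, ez, en]
    congr 1
    have hI : Complex.I ^ 2 = -1 := Complex.I_sq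
    set v := (τ n * u : ℝ) * Complex.I with hvdef
    have ev : (u : ℂ) ^ 2 = -(v ^ 2 / (τ n : ℂ) ^ 2) := by
      rw [hvdef]
      push_cast
      field_simp
      linear_combination (u : ℂ) ^ 2 * hI
    have ev2 : 2 * (c : ℂ) / (τ n : ℂ) ^ 3 * (τ n ^ 2 * u : ℝ) * Complex.I =
        2 * c / (τ n : ℂ) ^ 2 * v := by
      rw [hvdef]
      push_cast
      field_simp
    rw [ev, ev2]
    field_simp
    ring
  have hint : Tendsto (fun n => ∫ u, Q n u) atTop (𝓝 (√(Real.pi / (3 * c)) : ℝ)) := by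
    have hg : ((√(Real.pi / (3 * c)) : ℝ) : ℂ) =
        ∫ u : ℝ, ((Real.exp (-(3 * c) * u ^ 2) : ℝ) : ℂ) := by
      rw [integral_complex_ofReal, integral_gaussian]
    rw [hg]
    refine MeasureTheory.tendsto_integral_filter_of_dominated_convergence B ?_ ?_ hB
      (Eventually.of_forall hpt)
    · filter_upwards [hτ0] with n hn
      refine (Continuous.aestronglyMeasurable ?_).indicator measurableSet_Ioc
      have hc1 := (continuous_exp_of_hasEval hF hn).comp (continuous_const_mul (τ n ^ 2))
      have hc2 : Continuous fun u : ℝ => Complex.exp (n * (τ n ^ 2 * u : ℝ) * Complex.I) := by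
        fun_prop
      exact (hc1.div_const _).mul hc2
    · filter_upwards [hτ0, hτ.eventually (gt_mem_nhds one_pos)] with n hn hn1
      refine Eventually.of_forall fun u => ?_
      by_cases hu : u ∈ Set.Ioc (-(Real.pi / τ n ^ 2)) (Real.pi / τ n ^ 2)
      · have hu' : |τ n ^ 2 * u| ≤ Real.pi := by
          rw [abs_mul, abs_of_nonneg (sq_nonneg (τ n)), mul_comm, ← le_div_iff₀ (by positivity)]
          exact abs_le.mpr ⟨hu.1.le, hu.2⟩
        have h1 : ‖Complex.exp (n * (τ n ^ 2 * u : ℝ) * Complex.I)‖ = 1 := by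
          rw [← Complex.norm_exp_ofReal_mul_I (n * (τ n ^ 2 * u))]
          push_cast
          rfl
        simp only [hQ, Set.indicator_of_mem hu]
        rw [norm_mul, h1, mul_one, norm_div, div_le_iff₀ (norm_pos_iff.mpr (Complex.exp_ne_zero _)),
          mul_comm (B u)]
        exact hb _ hn hn1.le u hu'
      · simp only [hQ, Set.indicator_of_notMem hu, norm_zero]
        exact hB0 u
  have hfin := ((hR.sub_const (κ : ℂ)).cexp).mul (hint.mul_const ((√(3 * c / Real.pi) : ℝ) : ℂ))
  have e1 : √(Real.pi / (3 * c)) * √(3 * c / Real.pi) = 1 := by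
    rw [← Real.sqrt_mul (by positivity), div_mul_div_cancel₀ (by positivity),
      div_self Real.pi_ne_zero, Real.sqrt_one]
  rw [sub_self, Complex.exp_zero, one_mul, ← Complex.ofReal_mul, e1] at hfin
  have key : Tendsto (fun n : ℕ => ((PowerSeries.coeff n f / (Real.exp κ * τ n ^ β *
      Real.exp (c / τ n ^ 2 + n * τ n) * τ n ^ 2 / √(12 * Real.pi * c)) : ℝ) : ℂ)) atTop
      (𝓝 ((1 : ℝ) : ℂ)) := by
    refine hfin.congr' ?_
    filter_upwards [hcauchy, hτ0] with n hn hn0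
    have e2 : Complex.exp (M (τ n) - c / (τ n : ℂ) ^ 2 - β * Complex.log (τ n) - κ) =
        Complex.exp (M (τ n)) / ((Real.exp κ * τ n ^ β * Real.exp (c / τ n ^ 2) : ℝ) : ℂ) := by
      rw [Real.rpow_def_of_pos hn0, ← Real.exp_add, ← Real.exp_add, Complex.ofReal_exp,
        ← Complex.exp_sub]
      congr 1
      push_cast [Complex.ofReal_log hn0.le]
      ring
    have e3 : √(12 * Real.pi * c) = 2 * Real.pi * √(3 * c / Real.pi) := by
      have h : 12 * Real.pi * c = (2 * Real.pi) ^ 2 * (3 * c / Real.pi) := by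
        field_simp
        ring
      rw [h, Real.sqrt_mul (by positivity), Real.sqrt_sq (by positivity)]
    have hexp : Real.exp (c / τ n ^ 2 + n * τ n) = Real.exp (c / τ n ^ 2) * Real.exp (n * τ n) :=
      Real.exp_add _ _
    have hs : (0 : ℝ) < √(3 * c / Real.pi) := by
      have := Real.pi_pos
      positivity
    have n1 : ((Real.exp κ : ℝ) : ℂ) ≠ 0 := by exact_mod_cast (Real.exp_pos κ).ne'
    have n2 : ((τ n ^ β : ℝ) : ℂ) ≠ 0 := by exact_mod_cast (Real.rpow_pos_of_pos hn0 β).ne'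
    have n3 : ((Real.exp (c / τ n ^ 2) : ℝ) : ℂ) ≠ 0 := by exact_mod_cast (Real.exp_pos _).ne'
    have n4 : ((Real.exp (n * τ n) : ℝ) : ℂ) ≠ 0 := by exact_mod_cast (Real.exp_pos _).ne'
    have n5 : ((√(3 * c / Real.pi) : ℝ) : ℂ) ≠ 0 := by exact_mod_cast hs.ne'
    have n6 : (τ n : ℂ) ≠ 0 := by exact_mod_cast hn0.ne'
    have n7 : (Real.pi : ℂ) ≠ 0 := by exact_mod_cast Real.pi_ne_zero
    rw [e2, e3, hexp, Complex.ofReal_div, hn]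
    simp only [Complex.ofReal_mul, Complex.ofReal_div, Complex.ofReal_pow, Complex.ofReal_ofNat]
    field_simp
  exact_mod_cast (Complex.continuous_re.tendsto _).comp key

/-! ### Decay away from the real axis -/

theorem norm_one_add_le_mul_exp (w : ℂ) (hw : ‖w‖ ≤ 1) :
    ‖1 + w‖ ≤ (1 + ‖w‖) * Real.exp (-(‖w‖ - w.re) / 4) := by
  have hr := norm_nonneg w
  have hre := Complex.re_le_norm w
  refine le_of_sq_le_sq ?_ (by positivity)
  have h1 : ‖1 + w‖ ^ 2 = (1 + ‖w‖) ^ 2 - 2 * (‖w‖ - w.re) := by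
    rw [← Complex.normSq_eq_norm_sq, Complex.normSq_add]
    simp [Complex.normSq_eq_norm_sq]
    ring
  have h2 : Real.exp (-(‖w‖ - w.re) / 4) ^ 2 = Real.exp (-(‖w‖ - w.re) / 2) := by
    rw [← Real.exp_nat_mul]
    push_cast
    ring_nf
  have h3 : 1 - (‖w‖ - w.re) / 2 ≤ Real.exp (-(‖w‖ - w.re) / 2) := by
    linarith [Real.add_one_le_exp (-(‖w‖ - w.re) / 2)]
  rw [mul_pow, h1, h2]
  calc _ ≤ (1 + ‖w‖) ^ 2 * (1 - (‖w‖ - w.re) / 2) := by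
        have h4 : (1 + ‖w‖) ^ 2 ≤ 4 := by nlinarith
        have h5 := mul_le_mul_of_nonneg_right h4 (sub_nonneg.mpr hre)
        linarith
    _ ≤ _ := by gcongr

/-- The bound for `1 + w` gives that for `1 / (1 - w) = (1 + w) / (1 - w²)`, because
`|1 - w²| ≥ 1 - |w|²`. -/
theorem norm_inv_one_sub_le_mul_exp (w : ℂ) (hw : ‖w‖ < 1) :
    ‖(1 - w)⁻¹‖ ≤ (1 - ‖w‖)⁻¹ * Real.exp (-(‖w‖ - w.re) / 4) := by
  have h1 := norm_one_add_le_mul_exp w hw.le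
  have hr := norm_nonneg w
  have h2 : 1 - ‖w‖ ≤ ‖1 - w‖ := by simpa using norm_sub_norm_le 1 w
  have h3 : 1 - ‖w‖ ^ 2 ≤ ‖1 - w‖ * ‖1 + w‖ := by
    rw [← norm_mul, show (1 - w) * (1 + w) = 1 - w ^ 2 by ring]
    simpa [← norm_pow] using norm_sub_norm_le 1 (w ^ 2)
  have h4 : 0 < 1 - ‖w‖ := by linarith
  have h5 : 0 < ‖1 - w‖ := h4.trans_le h2
  rw [norm_inv, ← div_eq_inv_mul, le_div_iff₀ h4, inv_mul_le_iff₀ h5]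
  have h6 : (1 + ‖w‖) * (1 - ‖w‖) ≤
      (1 + ‖w‖) * (‖1 - w‖ * Real.exp (-(‖w‖ - w.re) / 4)) := by nlinarith
  exact le_of_mul_le_mul_left h6 (by linarith)

theorem norm_ratio_le_mul_exp (w : ℂ) (hw : ‖w‖ < 1) :
    ‖(1 + w) * (1 - w)⁻¹‖ ≤ (1 + ‖w‖) * (1 - ‖w‖)⁻¹ * Real.exp (-(‖w‖ - w.re) / 4) := by
  have h1 := norm_one_add_le_mul_exp w hw.le
  have hr := norm_nonneg w
  have h2 : 1 - ‖w‖ ≤ ‖1 - w‖ := by simpa using norm_sub_norm_le 1 w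
  have h4 : 0 < 1 - ‖w‖ := by linarith
  rw [norm_mul, norm_inv]
  calc _ ≤ (1 + ‖w‖) * Real.exp (-(‖w‖ - w.re) / 4) * (1 - ‖w‖)⁻¹ := by gcongr
    _ = _ := by ring

theorem sub_one_le_div_of_le {X T Y v : ℝ} (hX : 0 < X) (hXT : X ≤ T)
    (hY : 2 / 15 * (T * T * v ^ 2) ≤ Y) (hv : 0 ≤ v) (hTv : T * v ≤ 4) :
    2 / 15 * (v - 1) ≤ Y / (X * (X + Y)) := by
  have hT : 0 < T := hX.trans_le hXT
  have hY' : 0 ≤ Y := le_trans (by positivity) hY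
  have h1 : Y / (T * (T + Y)) ≤ Y / (X * (X + Y)) := by gcongr
  refine le_trans ?_ h1
  rcases le_or_gt v 1 with h | h
  · exact le_trans (by linarith) (show 0 ≤ Y / (T * (T + Y)) by positivity)
  rw [le_div_iff₀ (by positivity)]
  have h2 : 2 / 15 * (v - 1) * T ≤ 8 / 15 := by nlinarith
  -- the difference of the two sides is increasing in `Y`, so the least value of `Y` decides
  have h3 := mul_le_mul_of_nonneg_left hY (show 0 ≤ 1 - 2 / 15 * (v - 1) * T by linarith)
  have h4 : (v - 1) * (2 / 15 * (T * v) * v) ≤ (v - 1) * v := by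
    gcongr
    nlinarith
  have h5 : (v - 1) * (1 + 2 / 15 * (T * v) * v) ≤ v ^ 2 := by nlinarith
  have h6 := mul_le_mul_of_nonneg_left h5 (show 0 ≤ 2 / 15 * (T * T) by positivity)
  nlinarith

/-- The decay of the sum `∑ k (r^k - Re q^k)`, `q = e^(-(t + i y))`, `r = |q|`, as `y = t² u` moves
away from the real axis. -/
theorem abs_sub_one_le_div_one_sub_sq_sub {t : ℝ} (ht : 0 < t) (ht1 : t ≤ 1) {u : ℝ}
    (hu : |t ^ 2 * u| ≤ Real.pi) :
    2 / 45 * (|u| - 1) ≤ Real.exp (-t) / (1 - Real.exp (-t)) ^ 2 -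
      (Complex.exp (-(t + (t ^ 2 * u : ℝ) * Complex.I)) /
        (1 - Complex.exp (-(t + (t ^ 2 * u : ℝ) * Complex.I))) ^ 2).re := by
  set y := t ^ 2 * u with hy
  set q := Complex.exp (-(t + (y : ℂ) * Complex.I)) with hq
  set r := Real.exp (-t) with hr
  have hr0 : 0 < r := Real.exp_pos _
  have hr1 : r < 1 := by rw [hr, Real.exp_lt_one_iff]; linarith
  have hrt : 1 - r ≤ t := by linarith [Real.add_one_le_exp (-t)]
  have hr3 : 1 / 3 ≤ r := by
    have h1 : Real.exp (-1) ≤ r := Real.exp_le_exp.mpr (by linarith)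
    have h2 := Real.exp_neg_one_gt_d9
    linarith
  have hqn : ‖q‖ = r := by
    rw [hq, hr, Complex.norm_exp]
    simp
  have hqre : q.re = r * Real.cos y := by
    rw [hq, hr, Complex.exp_re]
    simp
  have hcos : Real.cos y ≤ 1 - 1 / 5 * y ^ 2 := by
    have h1 := Real.cos_le_one_sub_mul_cos_sq hu
    have h2 : 1 / 5 ≤ 2 / Real.pi ^ 2 := by
      rw [div_le_div_iff₀ (by norm_num) (by positivity)]
      nlinarith [Real.pi_lt_d2, Real.pi_pos]
    have h3 := mul_le_mul_of_nonneg_right h2 (sq_nonneg y)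
    linarith
  -- `|1 - q|² = X + Y`
  obtain ⟨X, hX⟩ : ∃ X, X = (1 - r) ^ 2 := ⟨_, rfl⟩
  obtain ⟨Y, hY⟩ : ∃ Y, Y = 2 * r * (1 - Real.cos y) := ⟨_, rfl⟩
  have hXY : ‖1 - q‖ ^ 2 = X + Y := by
    rw [← Complex.normSq_eq_norm_sq, Complex.normSq_sub, Complex.normSq_eq_norm_sq q, hqn]
    simp [hqre, hX, hY]
    ring
  have hX0 : 0 < X := by
    rw [hX]
    have : 0 < 1 - r := by linarith
    positivity
  have hXt : X ≤ t ^ 2 := by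
    rw [hX]
    have : 0 < 1 - r := by linarith
    gcongr
  have hY0 : 2 / 15 * y ^ 2 ≤ Y := by
    rw [hY]
    nlinarith [sq_nonneg y]
  have hYn : 0 ≤ Y := le_trans (by positivity) hY0
  have hre : (q / (1 - q) ^ 2).re ≤ r / (X + Y) := by
    refine (Complex.re_le_norm _).trans ?_
    rw [norm_div, norm_pow, hqn, hXY]
  have h1 : r / X - r / (X + Y) = r * (Y / (X * (X + Y))) := by
    have : X + Y ≠ 0 := by linarith
    field_simp
    ring
  have h2 : 2 / 15 * (|u| - 1) ≤ Y / (X * (X + Y)) := by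
    have ht2 : 0 < t ^ 2 := by positivity
    have hyu : y ^ 2 = t ^ 2 * t ^ 2 * |u| ^ 2 := by rw [hy, sq_abs]; ring
    have htu : t ^ 2 * |u| ≤ 4 := by
      rw [abs_mul, abs_of_pos ht2] at hu
      linarith [Real.pi_le_four]
    have hu0 := abs_nonneg u
    exact sub_one_le_div_of_le hX0 hXt (by rwa [hyu] at hY0) hu0 htu
  have h3 : 0 ≤ Y / (X * (X + Y)) := by positivity
  rw [← hX]
  calc 2 / 45 * (|u| - 1) = 1 / 3 * (2 / 15 * (|u| - 1)) := by ring
    _ ≤ 1 / 3 * (Y / (X * (X + Y))) := by gcongr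
    _ ≤ r * (Y / (X * (X + Y))) := by gcongr
    _ ≤ _ := by linarith

/-- The majorant for the integrand of Cauchy's formula, on the scale of the saddle point. -/
noncomputable def saddleMajorant (u : ℝ) : ℝ := Real.exp (1 / 90) * 16200 * (1 + u ^ 2)⁻¹

theorem integrable_saddleMajorant : MeasureTheory.Integrable saddleMajorant :=
  integrable_inv_one_add_sq.const_mul _

theorem saddleMajorant_nonneg (u : ℝ) : 0 ≤ saddleMajorant u := by
  unfold saddleMajorant
  positivity

/-- The constant `16200 = 2 * 90²` comes from `exp x ≥ 1 + x² / 2` at `x = |u| / 90`. -/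
theorem exp_neg_abs_sub_one_le_saddleMajorant (u : ℝ) :
    Real.exp (-(1 / 90 * (|u| - 1))) ≤ saddleMajorant u := by
  have h1 := Real.quadratic_le_exp_of_nonneg (show 0 ≤ |u| / 90 by positivity)
  have h2 : Real.exp (-(1 / 90 * (|u| - 1))) = Real.exp (1 / 90) * (Real.exp (|u| / 90))⁻¹ := by
    rw [← Real.exp_neg, ← Real.exp_add]
    ring_nf
  have h3 : (1 + u ^ 2) / 16200 ≤ Real.exp (|u| / 90) := by
    refine le_trans ?_ h1
    have := abs_nonneg u
    rw [← sq_abs u]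
    nlinarith
  rw [h2, saddleMajorant, mul_assoc]
  gcongr
  refine (inv_anti₀ (by positivity) h3).trans_eq ?_
  rw [inv_div, div_eq_mul_inv]

/-- If the factors satisfy `|p(w)| ≤ |p(|w|)| exp (-(|w| - Re w) / 4)`, then `exp M` decays along
`Re z = t` at least as fast as `saddleMajorant`, on the scale `t²`. -/
theorem norm_exp_le_of_tendsto_prod {p : ℂ → ℂ}
    (hp : ∀ w : ℂ, ‖w‖ < 1 → ‖p w‖ ≤ ‖p (‖w‖ : ℝ)‖ * Real.exp (-(‖w‖ - w.re) / 4))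
    {M : ℂ → ℂ} {m : ℕ} (hm : 0 < m) (hprod : ∀ z : ℂ, 0 < z.re → Tendsto (fun K =>
      ∏ k ∈ Finset.range K, p (Complex.exp (-z) ^ (k + 1)) ^ (m * (k + 1))) atTop
        (𝓝 (Complex.exp (M z))))
    {t : ℝ} (ht : 0 < t) (ht1 : t ≤ 1) {u : ℝ} (hu : |t ^ 2 * u| ≤ Real.pi) :
    ‖Complex.exp (M (t + (t ^ 2 * u : ℝ) * Complex.I))‖ ≤
      ‖Complex.exp (M t)‖ * saddleMajorant u := by
  have hD := abs_sub_one_le_div_one_sub_sq_sub ht ht1 hu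
  set z : ℂ := t + (t ^ 2 * u : ℝ) * Complex.I with hz
  have hzre : z.re = t := by simp [hz, -Complex.ofReal_mul, -Complex.ofReal_pow]
  set q := Complex.exp (-z) with hq
  set r := Real.exp (-t) with hr
  have hr0 : 0 < r := Real.exp_pos _
  have hr1 : r < 1 := by rw [hr, Real.exp_lt_one_iff]; linarith
  have hqn : ‖q‖ = r := by rw [hq, hr, Complex.norm_exp, Complex.neg_re, hzre]
  have hrt : Complex.exp (-(t : ℂ)) = (r : ℂ) := by rw [hr]; push_cast; rfl
  have hs1 : HasSum (fun k : ℕ => ((k + 1 : ℕ) : ℝ) * r ^ (k + 1)) (r / (1 - r) ^ 2) := by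
    have := hasSum_coe_mul_geometric_of_norm_lt_one (𝕜 := ℝ) (r := r)
      (by rwa [Real.norm_of_nonneg hr0.le])
    rw [← hasSum_nat_add_iff' 1] at this
    simpa using this
  have hs2 : HasSum (fun k : ℕ => ((k + 1 : ℕ) : ℂ) * q ^ (k + 1)) (q / (1 - q) ^ 2) := by
    have := hasSum_coe_mul_geometric_of_norm_lt_one (𝕜 := ℂ) (r := q) (by rwa [hqn])
    rw [← hasSum_nat_add_iff' 1] at this
    simpa using this
  set d : ℕ → ℝ := fun k => ((k + 1 : ℕ) : ℝ) * (r ^ (k + 1) - (q ^ (k + 1)).re) with hd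
  have hd0 : ∀ k, 0 ≤ d k := fun k => by
    have := Complex.re_le_norm (q ^ (k + 1))
    rw [norm_pow, hqn] at this
    exact mul_nonneg (Nat.cast_nonneg _) (by linarith)
  -- `d` sums to the difference bounded from below in `hD`
  have hs : HasSum d (r / (1 - r) ^ 2 - (q / (1 - q) ^ 2).re) := by
    have e : d = fun k => ((k + 1 : ℕ) : ℝ) * r ^ (k + 1) -
        (((k + 1 : ℕ) : ℂ) * q ^ (k + 1)).re := by
      funext k
      rw [← Complex.ofReal_natCast, Complex.re_ofReal_mul, ← mul_sub]
    rw [e]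
    exact hs1.sub (Complex.hasSum_re hs2)
  have hle : ∀ K, ‖∏ k ∈ Finset.range K, p (q ^ (k + 1)) ^ (m * (k + 1))‖ ≤
      ‖∏ k ∈ Finset.range K, p (Complex.exp (-(t : ℂ)) ^ (k + 1)) ^ (m * (k + 1))‖ *
        Real.exp (-(1 / 4) * ∑ k ∈ Finset.range K, d k) := by
    intro K
    rw [Finset.mul_sum, Real.exp_sum, norm_prod, norm_prod, ← Finset.prod_mul_distrib]
    refine Finset.prod_le_prod (fun _ _ => norm_nonneg _) fun k _ => ?_
    have hn : ‖q ^ (k + 1)‖ = r ^ (k + 1) := by rw [norm_pow, hqn]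
    have h1 := hp (q ^ (k + 1)) (by
      rw [hn]; exact pow_lt_one₀ hr0.le hr1 (by omega))
    rw [hn] at h1
    have h2 : Real.exp (-(r ^ (k + 1) - (q ^ (k + 1)).re) / 4) ^ (m * (k + 1)) ≤
        Real.exp (-(1 / 4) * d k) := by
      rw [← Real.exp_nat_mul, Real.exp_le_exp]
      have hm1 : (1 : ℝ) ≤ m := by exact_mod_cast hm
      have := hd0 k
      have e : ((m * (k + 1) : ℕ) : ℝ) * (-(r ^ (k + 1) - (q ^ (k + 1)).re) / 4) =
          -(1 / 4) * (m * d k) := by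
        simp only [hd]
        push_cast
        ring
      rw [e]
      nlinarith
    rw [norm_pow, norm_pow, hrt, ← Complex.ofReal_pow]
    calc _ ≤ (‖p ((r ^ (k + 1) : ℝ) : ℂ)‖ *
          Real.exp (-(r ^ (k + 1) - (q ^ (k + 1)).re) / 4)) ^ (m * (k + 1)) := by gcongr
      _ = ‖p ((r ^ (k + 1) : ℝ) : ℂ)‖ ^ (m * (k + 1)) *
          Real.exp (-(r ^ (k + 1) - (q ^ (k + 1)).re) / 4) ^ (m * (k + 1)) := mul_pow _ _ _
      _ ≤ _ := by gcongr
  have hexp : Tendsto (fun K => Real.exp (-(1 / 4) * ∑ k ∈ Finset.range K, d k)) atTop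
      (𝓝 (Real.exp (-(1 / 4) * (r / (1 - r) ^ 2 - (q / (1 - q) ^ 2).re)))) :=
    (Real.continuous_exp.tendsto _).comp (hs.tendsto_sum_nat.const_mul _)
  have h := le_of_tendsto_of_tendsto' (hprod z (by rw [hzre]; exact ht)).norm
    ((hprod t (by simpa using ht)).norm.mul hexp) hle
  refine h.trans ?_
  gcongr
  refine le_trans ?_ (exp_neg_abs_sub_one_le_saddleMajorant u)
  rw [Real.exp_le_exp]
  linarith

/-! ### Asymptotics of the coefficients -/

theorem tendsto_two_mul_sector : Tendsto (fun z : ℂ => 2 * z) (𝓝[sector] 0) (𝓝[sector] 0) := by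
  refine tendsto_nhdsWithin_iff.mpr ⟨?_, ?_⟩
  · have : Tendsto (fun z : ℂ => 2 * z) (𝓝 0) (𝓝 (2 * 0)) := tendsto_id.const_mul _
    rw [mul_zero] at this
    exact this.mono_left nhdsWithin_le_nhds
  · filter_upwards [self_mem_nhdsWithin] with z hz
    have h1 : (2 * z).re = 2 * z.re := by simp
    refine ⟨by rw [h1]; linarith [hz.1], ?_⟩
    rw [h1, norm_mul, Complex.norm_ofNat]
    linarith [hz.2]

theorem tendsto_logMacMahon_two_mul_sub :
    Tendsto (fun z => logMacMahon (2 * z) - zetaThree / 4 / z ^ 2 - Complex.log z / 12)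
      (𝓝[sector] 0) (𝓝 ((1 / 12 - Real.log glaisherKinkelin + Real.log 2 / 12 : ℝ) : ℂ)) := by
  have h := (tendsto_logMacMahon_sub.comp tendsto_two_mul_sector).add_const
    ((Real.log 2 / 12 : ℝ) : ℂ)
  rw [← Complex.ofReal_add] at h
  refine h.congr' ?_
  filter_upwards [self_mem_nhdsWithin] with z hz
  have hz0 : z ≠ 0 := sector_subset_ne_zero hz
  have hl : Complex.log (2 * z) = Real.log 2 + Complex.log z := by
    have := Complex.log_ofReal_mul (r := 2) two_pos hz0
    exact_mod_cast this
  simp only [Function.comp_apply]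
  rw [hl]
  push_cast
  field_simp
  ring

/-- The asymptotic form of the coefficients, with the saddle point `(2c / n)^(1/3)` eliminated. -/
theorem isEquivalent_coeff_saddle {f : PowerSeries ℝ} {M : ℂ → ℂ}
    (hF : ∀ z : ℂ, 0 < z.re → HasEval f (Complex.exp (-z)) (Complex.exp (M z)))
    {c β κ : ℝ} (hc : 0 < c)
    (hM : Tendsto (fun z => M z - c / z ^ 2 - β * Complex.log z) (𝓝[sector] 0) (𝓝 (κ : ℂ)))
    (hb : ∀ t : ℝ, 0 < t → t ≤ 1 → ∀ u : ℝ, |t ^ 2 * u| ≤ Real.pi →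
      ‖Complex.exp (M (t + (t ^ 2 * u : ℝ) * Complex.I))‖ ≤
        ‖Complex.exp (M t)‖ * saddleMajorant u)
    {F : ℕ → ℝ} (hFn : ∀ n : ℕ, 0 < n → F n = Real.exp (κ +
      (β + 2) / 3 * (Real.log (2 * c) - Real.log n) + 3 / 2 * (2 * c) ^ (1 / 3 : ℝ) *
        (n : ℝ) ^ (2 / 3 : ℝ) - 1 / 2 * Real.log (12 * Real.pi * c))) :
    (fun n : ℕ => PowerSeries.coeff n f) ~[atTop] F := by
  set τ : ℕ → ℝ := fun n => (2 * c / n) ^ (1 / 3 : ℝ) with hτdef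
  have hpos : ∀ n : ℕ, 0 < n → 0 < τ n := fun n hn => by
    have : (0 : ℝ) < n := by exact_mod_cast hn
    simp only [hτdef]
    positivity
  have hτ0 : ∀ᶠ n in atTop, 0 < τ n := by
    filter_upwards [eventually_gt_atTop 0] with n hn using hpos n hn
  have hcube : ∀ n : ℕ, τ n ^ 3 = 2 * c / n := fun n => by
    simp only [hτdef]
    rw [← Real.rpow_natCast, ← Real.rpow_mul (by positivity)]
    norm_num
  have hτn : ∀ n : ℕ, 0 < n → n * τ n ^ 3 = 2 * c := fun n hn => by
    have : (n : ℝ) ≠ 0 := by exact_mod_cast hn.ne'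
    rw [hcube, mul_div_cancel₀ _ this]
  have hτ : Tendsto τ atTop (𝓝 0) := by
    have h1 : Tendsto (fun n : ℕ => 2 * c / (n : ℝ)) atTop (𝓝 0) :=
      tendsto_const_nhds.div_atTop tendsto_natCast_atTop_atTop
    have h2 := h1.rpow_const (p := (1 / 3 : ℝ)) (Or.inr (by norm_num))
    rwa [Real.zero_rpow (by norm_num)] at h2
  refine isEquivalent_of_tendsto_one ((tendsto_coeff_div_saddle hF hc hM integrable_saddleMajorant
    saddleMajorant_nonneg hb hτ0 hτ ((eventually_gt_atTop 0).mono hτn)).congr' ?_)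
  filter_upwards [eventually_gt_atTop 0] with n hn
  have hn' : (0 : ℝ) < n := by exact_mod_cast hn
  have ht := hpos n hn
  have h1 : Real.log (τ n) = 1 / 3 * (Real.log (2 * c) - Real.log n) := by
    simp only [hτdef]
    rw [Real.log_rpow (by positivity), Real.log_div (by positivity) (by positivity)]
  have h2 : n * τ n = (2 * c) ^ (1 / 3 : ℝ) * (n : ℝ) ^ (2 / 3 : ℝ) := by
    simp only [hτdef]
    rw [Real.div_rpow (by positivity) hn'.le]
    have : (n : ℝ) = (n : ℝ) ^ (1 / 3 : ℝ) * (n : ℝ) ^ (2 / 3 : ℝ) := by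
      rw [← Real.rpow_add hn']
      norm_num
    have h0 : (n : ℝ) ^ (1 / 3 : ℝ) ≠ 0 := (Real.rpow_pos_of_pos hn' _).ne'
    nth_rewrite 1 [this]
    field_simp
  have h3 : c / τ n ^ 2 = n * τ n / 2 := by
    have := hτn n hn
    field_simp
    linarith
  have hpi := Real.pi_pos
  have e1 : √(12 * Real.pi * c) = Real.exp (1 / 2 * Real.log (12 * Real.pi * c)) := by
    rw [Real.sqrt_eq_rpow, Real.rpow_def_of_pos (by positivity), mul_comm]
  have e2 : τ n ^ 2 = Real.exp (2 * Real.log (τ n)) := by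
    rw [mul_comm, ← Real.rpow_def_of_pos ht, Real.rpow_ofNat]
  rw [Pi.div_apply, hFn n hn, h3, e1, e2, Real.rpow_def_of_pos ht, ← Real.exp_add, ← Real.exp_add,
    ← Real.exp_add, ← Real.exp_sub]
  congr 2
  rw [h1, h2]
  ring

theorem ofReal_norm_exp_neg (z : ℂ) :
    ((‖Complex.exp (-z)‖ : ℝ) : ℂ) = Complex.exp (-(z.re : ℂ)) := by
  rw [norm_exp_neg_eq]
  push_cast
  rfl

theorem hasEval_genMinus (m : ℕ) {z : ℂ} (hz : 0 < z.re) :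
    HasEval (genMinus m) (Complex.exp (-z)) (Complex.exp (m * logMacMahon z)) := by
  refine HasEval.tprod (v := fun k q => ((1 - q ^ (k + 1))⁻¹) ^ (m * (k + 1)))
    (fun k => X_pow_dvd_pow_sub_one _ _ _ ?_)
    (fun k => PowerSeries.coeff_pow_nonneg (coeff_inv_one_sub_X_pow_nonneg k.succ_ne_zero) _)
    (fun k q hq => (HasEval.inv_one_sub_X_pow hq k.succ_ne_zero).pow _) (norm_exp_neg_lt_one hz)
    (tendsto_prod_inv_one_sub_exp m hz) (W := Complex.exp (m * logMacMahon z.re)) ?_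
  · exact ⟨(1 - PowerSeries.X ^ (k + 1))⁻¹, by linear_combination one_sub_X_pow_mul_inv k⟩
  · rw [ofReal_norm_exp_neg]
    exact tendsto_prod_inv_one_sub_exp m (by simpa using hz)

theorem hasEval_genPlus (m : ℕ) {z : ℂ} (hz : 0 < z.re) :
    HasEval (genPlus m) (Complex.exp (-z))
      (Complex.exp (m * (logMacMahon z - logMacMahon (2 * z)))) := by
  refine HasEval.tprod (v := fun k q => (1 + q ^ (k + 1)) ^ (m * (k + 1)))
    (fun k => X_pow_dvd_pow_sub_one _ _ _ ?_)
    (fun k => PowerSeries.coeff_pow_nonneg (coeff_one_add_X_pow_nonneg _) _)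
    (fun k q hq => (HasEval.one_add_X_pow q k.succ_ne_zero).pow _) (norm_exp_neg_lt_one hz)
    (tendsto_prod_one_add_exp m hz)
    (W := Complex.exp (m * (logMacMahon z.re - logMacMahon (2 * z.re)))) ?_
  · exact ⟨1, by ring⟩
  · rw [ofReal_norm_exp_neg]
    exact tendsto_prod_one_add_exp m (by simpa using hz)

theorem hasEval_genRatio (m : ℕ) {z : ℂ} (hz : 0 < z.re) :
    HasEval (genRatio m) (Complex.exp (-z))
      (Complex.exp (m * (2 * logMacMahon z - logMacMahon (2 * z)))) := by
  refine HasEval.tprod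
    (v := fun k q => ((1 + q ^ (k + 1)) * (1 - q ^ (k + 1))⁻¹) ^ (m * (k + 1)))
    (fun k => X_pow_dvd_pow_sub_one _ _ _ ?_)
    (fun k => PowerSeries.coeff_pow_nonneg (PowerSeries.coeff_mul_nonneg
      (coeff_one_add_X_pow_nonneg _) (coeff_inv_one_sub_X_pow_nonneg k.succ_ne_zero)) _)
    (fun k q hq => ((HasEval.one_add_X_pow q k.succ_ne_zero).mul
      (HasEval.inv_one_sub_X_pow hq k.succ_ne_zero)).pow _) (norm_exp_neg_lt_one hz)
    (tendsto_prod_ratio_exp m hz)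
    (W := Complex.exp (m * (2 * logMacMahon z.re - logMacMahon (2 * z.re)))) ?_
  · exact ⟨2 * (1 - PowerSeries.X ^ (k + 1))⁻¹, by linear_combination one_sub_X_pow_mul_inv k⟩
  · rw [ofReal_norm_exp_neg]
    exact tendsto_prod_ratio_exp m (by simpa using hz)

theorem norm_one_sub_norm_inv {w : ℂ} (hw : ‖w‖ < 1) :
    ‖(1 - ((‖w‖ : ℝ) : ℂ))⁻¹‖ = (1 - ‖w‖)⁻¹ := by
  rw [norm_inv, ← Complex.ofReal_one, ← Complex.ofReal_sub, Complex.norm_real,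
    Real.norm_of_nonneg (by linarith)]

theorem norm_one_add_norm (w : ℂ) : ‖1 + ((‖w‖ : ℝ) : ℂ)‖ = 1 + ‖w‖ := by
  rw [← Complex.ofReal_one, ← Complex.ofReal_add, Complex.norm_real,
    Real.norm_of_nonneg (by positivity)]

theorem isEquivalent_coeff_genRatio (m : ℕ) (hm : 0 < m) :
    (fun n : ℕ => PowerSeries.coeff n (genRatio m)) ~[atTop] fun n : ℕ =>
      (7 * m * zetaThree) ^ (1 / 6 + (m : ℝ) / 36) *
          Real.exp ((m : ℝ) / 12 + 3 * (7 * m * zetaThree) ^ (1 / 3 : ℝ) *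
            (n : ℝ) ^ (2 / 3 : ℝ) / 2 ^ (4 / 3 : ℝ)) /
        (glaisherKinkelin ^ m * 2 ^ (2 / 3 + (m : ℝ) / 9) * √3 * Real.pi ^ (1 / 2 : ℝ) *
          (n : ℝ) ^ (2 / 3 + (m : ℝ) / 36)) := by
  have hm' : (0 : ℝ) < m := by exact_mod_cast hm
  have hζ := zetaThree_pos
  have hA := glaisherKinkelin_pos
  have hpi := Real.pi_pos
  refine isEquivalent_coeff_saddle (c := 7 * m * zetaThree / 4) (β := m / 12)
    (κ := m * (1 / 12 - Real.log glaisherKinkelin - Real.log 2 / 12))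
    (fun z hz => hasEval_genRatio m hz) (by positivity) ?_ (fun t ht ht1 u hu =>
      norm_exp_le_of_tendsto_prod (p := fun w => (1 + w) * (1 - w)⁻¹) (fun w hw => ?_) hm
        (fun z hz => tendsto_prod_ratio_exp m hz) ht ht1 hu) fun n hn => ?_
  · have h := ((tendsto_logMacMahon_sub.const_mul 2).sub tendsto_logMacMahon_two_mul_sub).const_mul
      (m : ℂ)
    convert h using 2
    · push_cast
      ring
    · push_cast
      ring
  · rw [norm_mul ((1 : ℂ) + (‖w‖ : ℝ)), norm_one_add_norm, norm_one_sub_norm_inv hw]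
    exact norm_ratio_le_mul_exp w hw
  · have hn' : (0 : ℝ) < n := by exact_mod_cast hn
    have h2 : (2 : ℝ) * (7 * m * zetaThree / 4) = 7 * m * zetaThree / 2 := by ring
    have h3 : 3 / 2 * (7 * m * zetaThree / 2) ^ (1 / 3 : ℝ) =
        3 * (7 * m * zetaThree) ^ (1 / 3 : ℝ) / 2 ^ (4 / 3 : ℝ) := by
      rw [Real.div_rpow (by positivity) two_pos.le, show (4 / 3 : ℝ) = 1 + 1 / 3 by norm_num,
        Real.rpow_add two_pos, Real.rpow_one]
      field_simp
    have h4 : Real.log (12 * Real.pi * (7 * m * zetaThree / 4)) =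
        Real.log 3 + Real.log Real.pi + Real.log (7 * m * zetaThree) := by
      rw [← Real.log_mul (by norm_num) hpi.ne', ← Real.log_mul (by positivity) (by positivity)]
      ring_nf
    have h5 : glaisherKinkelin ^ m = Real.exp (Real.log glaisherKinkelin * m) := by
      rw [← Real.rpow_def_of_pos hA, Real.rpow_natCast]
    rw [h2, h3, h4, Real.log_div (by positivity) two_ne_zero, h5, Real.sqrt_eq_rpow,
      mul_div_right_comm (3 * (7 * m * zetaThree) ^ (1 / 3 : ℝ))]
    generalize 3 * (7 * m * zetaThree) ^ (1 / 3 : ℝ) / 2 ^ (4 / 3 : ℝ) * (n : ℝ) ^ (2 / 3 : ℝ) = E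
    rw [Real.rpow_def_of_pos (by positivity : 0 < 7 * (m : ℝ) * zetaThree),
      Real.rpow_def_of_pos two_pos, Real.rpow_def_of_pos three_pos, Real.rpow_def_of_pos hpi,
      Real.rpow_def_of_pos hn']
    simp only [← Real.exp_add, ← Real.exp_sub]
    congr 1
    ring

theorem isEquivalent_coeff_genMinus (m : ℕ) (hm : 0 < m) :
    (fun n : ℕ => PowerSeries.coeff n (genMinus m)) ~[atTop] fun n : ℕ =>
      (m * zetaThree) ^ ((m : ℝ) / 36 + 1 / 6) *
          Real.exp ((m : ℝ) / 12 + 3 * (m * zetaThree) ^ (1 / 3 : ℝ) *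
            (n : ℝ) ^ (2 / 3 : ℝ) / 2 ^ (2 / 3 : ℝ)) /
        (glaisherKinkelin ^ m * 2 ^ (1 / 3 - (m : ℝ) / 36) * 3 ^ (1 / 2 : ℝ) *
          Real.pi ^ (1 / 2 : ℝ) * (n : ℝ) ^ ((m : ℝ) / 36 + 2 / 3)) := by
  have hm' : (0 : ℝ) < m := by exact_mod_cast hm
  have hζ := zetaThree_pos
  have hA := glaisherKinkelin_pos
  have hpi := Real.pi_pos
  refine isEquivalent_coeff_saddle (c := m * zetaThree) (β := m / 12)
    (κ := m * (1 / 12 - Real.log glaisherKinkelin))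
    (fun z hz => hasEval_genMinus m hz) (by positivity) ?_ (fun t ht ht1 u hu =>
      norm_exp_le_of_tendsto_prod (p := fun w => (1 - w)⁻¹) (fun w hw => ?_) hm
        (fun z hz => tendsto_prod_inv_one_sub_exp m hz) ht ht1 hu) fun n hn => ?_
  · convert tendsto_logMacMahon_sub.const_mul (m : ℂ) using 2
    · push_cast
      ring
    · push_cast
      ring
  · rw [norm_one_sub_norm_inv hw]
    exact norm_inv_one_sub_le_mul_exp w hw
  · have hn' : (0 : ℝ) < n := by exact_mod_cast hn
    have h3 : 3 / 2 * (2 * (m * zetaThree)) ^ (1 / 3 : ℝ) =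
        3 * (m * zetaThree) ^ (1 / 3 : ℝ) / 2 ^ (2 / 3 : ℝ) := by
      have h : (2 : ℝ) = 2 ^ (1 / 3 : ℝ) * 2 ^ (2 / 3 : ℝ) := by
        rw [← Real.rpow_add two_pos]
        norm_num
      rw [Real.mul_rpow two_pos.le (by positivity)]
      field_simp
      linear_combination -h
    have h4 : Real.log (12 * Real.pi * (m * zetaThree)) =
        2 * Real.log 2 + Real.log 3 + Real.log Real.pi + Real.log (m * zetaThree) := by
      have h12 : Real.log 12 = 2 * Real.log 2 + Real.log 3 := by
        rw [show (12 : ℝ) = 2 ^ 2 * 3 by norm_num, Real.log_mul (by norm_num) (by norm_num),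
          Real.log_pow]
        norm_num
      rw [Real.log_mul (by positivity) (by positivity), Real.log_mul (by norm_num) hpi.ne', h12]
    have h5 : glaisherKinkelin ^ m = Real.exp (Real.log glaisherKinkelin * m) := by
      rw [← Real.rpow_def_of_pos hA, Real.rpow_natCast]
    rw [h3, h4, Real.log_mul two_ne_zero (by positivity), h5,
      mul_div_right_comm (3 * (m * zetaThree) ^ (1 / 3 : ℝ))]
    generalize 3 * (m * zetaThree) ^ (1 / 3 : ℝ) / 2 ^ (2 / 3 : ℝ) * (n : ℝ) ^ (2 / 3 : ℝ) = E
    rw [Real.rpow_def_of_pos (by positivity : 0 < (m : ℝ) * zetaThree),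
      Real.rpow_def_of_pos two_pos, Real.rpow_def_of_pos three_pos, Real.rpow_def_of_pos hpi,
      Real.rpow_def_of_pos hn']
    simp only [← Real.exp_add, ← Real.exp_sub]
    congr 1
    ring

theorem isEquivalent_coeff_genPlus (m : ℕ) (hm : 0 < m) :
    (fun n : ℕ => PowerSeries.coeff n (genPlus m)) ~[atTop] fun n : ℕ =>
      (m * zetaThree) ^ (1 / 6 : ℝ) *
          Real.exp (3 ^ (4 / 3 : ℝ) * (m * zetaThree) ^ (1 / 3 : ℝ) *
            (n : ℝ) ^ (2 / 3 : ℝ) / 2 ^ (4 / 3 : ℝ)) /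
        (2 ^ ((m : ℝ) / 12 + 2 / 3) * 3 ^ (1 / 3 : ℝ) * √Real.pi * (n : ℝ) ^ (2 / 3 : ℝ)) := by
  have hm' : (0 : ℝ) < m := by exact_mod_cast hm
  have hζ := zetaThree_pos
  have hpi := Real.pi_pos
  refine isEquivalent_coeff_saddle (c := 3 * (m * zetaThree) / 4) (β := 0)
    (κ := -(m * Real.log 2 / 12))
    (fun z hz => hasEval_genPlus m hz) (by positivity) ?_ (fun t ht ht1 u hu =>
      norm_exp_le_of_tendsto_prod (p := fun w => 1 + w) (fun w hw => ?_) hm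
        (fun z hz => tendsto_prod_one_add_exp m hz) ht ht1 hu) fun n hn => ?_
  · convert (tendsto_logMacMahon_sub.sub tendsto_logMacMahon_two_mul_sub).const_mul (m : ℂ) using 2
    · push_cast
      ring
    · push_cast
      ring
  · rw [norm_one_add_norm]
    exact norm_one_add_le_mul_exp w hw.le
  · have hn' : (0 : ℝ) < n := by exact_mod_cast hn
    have h2 : (2 : ℝ) * (3 * (m * zetaThree) / 4) = 3 * (m * zetaThree) / 2 := by ring
    have h3 : 3 / 2 * (3 * (m * zetaThree) / 2) ^ (1 / 3 : ℝ) =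
        3 ^ (4 / 3 : ℝ) * (m * zetaThree) ^ (1 / 3 : ℝ) / 2 ^ (4 / 3 : ℝ) := by
      rw [Real.div_rpow (by positivity) two_pos.le, Real.mul_rpow three_pos.le (by positivity),
        show (4 / 3 : ℝ) = 1 + 1 / 3 by norm_num, Real.rpow_add two_pos, Real.rpow_add three_pos,
        Real.rpow_one, Real.rpow_one]
      field_simp
    have h4 : Real.log (12 * Real.pi * (3 * (m * zetaThree) / 4)) =
        2 * Real.log 3 + Real.log Real.pi + Real.log (m * zetaThree) := by
      have h9 : Real.log 9 = 2 * Real.log 3 := by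
        rw [show (9 : ℝ) = 3 ^ 2 by norm_num, Real.log_pow]
        norm_num
      rw [← h9, ← Real.log_mul (by norm_num) hpi.ne',
        ← Real.log_mul (by positivity) (by positivity)]
      ring_nf
    rw [h2, h3, h4, Real.log_div (by positivity) two_ne_zero,
      Real.log_mul three_ne_zero (by positivity), Real.sqrt_eq_rpow,
      mul_div_right_comm (3 ^ (4 / 3 : ℝ) * (m * zetaThree) ^ (1 / 3 : ℝ))]
    generalize 3 ^ (4 / 3 : ℝ) * (m * zetaThree) ^ (1 / 3 : ℝ) / 2 ^ (4 / 3 : ℝ) *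
      (n : ℝ) ^ (2 / 3 : ℝ) = E
    rw [Real.rpow_def_of_pos (by positivity : 0 < (m : ℝ) * zetaThree),
      Real.rpow_def_of_pos two_pos, Real.rpow_def_of_pos three_pos, Real.rpow_def_of_pos hpi,
      Real.rpow_def_of_pos hn']
    simp only [← Real.exp_add, ← Real.exp_sub]
    congr 1
    ring

theorem mainTheorem10 (m : ℕ) (hm : 0 < m) :
    ((fun n : ℕ => PowerSeries.coeff n (genRatio m)) ~[atTop] fun n : ℕ =>
      (7 * m * zetaThree) ^ (1 / 6 + (m : ℝ) / 36) *
          Real.exp ((m : ℝ) / 12 + 3 * (7 * m * zetaThree) ^ (1 / 3 : ℝ) *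
            (n : ℝ) ^ (2 / 3 : ℝ) / 2 ^ (4 / 3 : ℝ)) /
        (glaisherKinkelin ^ m * 2 ^ (2 / 3 + (m : ℝ) / 9) * √3 * Real.pi ^ (1 / 2 : ℝ) *
          (n : ℝ) ^ (2 / 3 + (m : ℝ) / 36))) ∧
    ((fun n : ℕ => PowerSeries.coeff n (genMinus m)) ~[atTop] fun n : ℕ =>
      (m * zetaThree) ^ ((m : ℝ) / 36 + 1 / 6) *
          Real.exp ((m : ℝ) / 12 + 3 * (m * zetaThree) ^ (1 / 3 : ℝ) *
            (n : ℝ) ^ (2 / 3 : ℝ) / 2 ^ (2 / 3 : ℝ)) /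
        (glaisherKinkelin ^ m * 2 ^ (1 / 3 - (m : ℝ) / 36) * 3 ^ (1 / 2 : ℝ) *
          Real.pi ^ (1 / 2 : ℝ) * (n : ℝ) ^ ((m : ℝ) / 36 + 2 / 3))) ∧
    ((fun n : ℕ => PowerSeries.coeff n (genPlus m)) ~[atTop] fun n : ℕ =>
      (m * zetaThree) ^ (1 / 6 : ℝ) *
          Real.exp (3 ^ (4 / 3 : ℝ) * (m * zetaThree) ^ (1 / 3 : ℝ) *
            (n : ℝ) ^ (2 / 3 : ℝ) / 2 ^ (4 / 3 : ℝ)) /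
        (2 ^ ((m : ℝ) / 12 + 2 / 3) * 3 ^ (1 / 3 : ℝ) * √Real.pi * (n : ℝ) ^ (2 / 3 : ℝ))) :=
  ⟨isEquivalent_coeff_genRatio m hm, isEquivalent_coeff_genMinus m hm,
    isEquivalent_coeff_genPlus m hm⟩
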